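/- An $n$-string double wiring diagram consists of $n$ red and $n$ blue piecewise linear strings running from left to right at heights $1,\dots,n$, such that any two strings of the same color cross exactly once, at adjacent heights; it is considered through the sequence, from left to right, of its crossings (color and height). At the left end the red strings are numbered $1,\dots,n$ from top to bottom and the blue strings $1,\dots,n$ from bottom to top. Each chamber with at least one string of each color below it (including the chamber above all strings) is labeled by $(r,b)$, where $r,b\subseteq\{1,\dots,n\}$ are the sets of numbers of the red, respectively blue, strings passing below the chamber; always $|r|=|b|$. Two double wiring diagrams belong to the same commutation class if they have the same set of chamber labels. For an $n\times n$ matrix $M$ and $I,J\subseteq\{1,\dots,n\}$ with $|I|=|J|$, let $\Delta_{I,J}(M)$ be the minor of $M$ with row set $I$ and column set $J$. The chamber minors of a commutation class $w$ are the $\Delta_{r,b}$ for the chamber labels $(r,b)$ of $w$. Theorem. Let $n\le 4$, let $w$ be a commutation class of $n$-string double wiring diagrams, and let $I,J\subseteq\{1,\dots,n\}$ with $|I|=|J|$. Then $\Delta_{I,J}$ is a Laurent polynomial with positive (integer) coefficients in the chamber minors of $w$: there is a Laurent polynomial $f$ in variables indexed by the chamber labels of $w$, all of whose nonzero coefficients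 are positive integers, such that for every field $K$ and every $n\times n$ matrix $M$ over $K$ whose chamber minors $\Delta_{r,b}(M)$ are all nonzero, $\Delta_{I,J}(M)$ is the value of $f$ at the chamber minors of $M$. -/

import Mathlib

/-- The two colours of strings in a double wiring diagram. -/
inductive StringColor where
  | red
  | blue
  deriving DecidableEq

namespace StringColor

/-- The order of the `n` strings of a given colour at the left end of a double wiring diagram,
as a map from positions (counted from the bottom) to labels. Red strings are numbered from top to
bottom, blue strings from bottom to top. (Positions and labels are counted from `0`.) -/
def leftOrder (n : ℕ) : StringColor → Equiv.Perm (Fin n)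
  | red => Fin.revPerm
  | blue => 1

end StringColor

/-- A crossing of two strings of the same colour, the ones in the adjacent positions `level` and
`level + 1` counted from the bottom. -/
structure StringCrossing (n : ℕ) where
  color : StringColor
  level : Fin (n - 1)
  deriving DecidableEq

namespace StringCrossing

variable {n : ℕ}

/-- The lower of the two positions that are exchanged at a crossing. -/
def lowerPos (x : StringCrossing n) : Fin n :=
  ⟨x.level.1, lt_of_lt_of_le x.level.2 (Nat.sub_le n 1)⟩

/-- The upper of the two positions that are exchanged at a crossing. -/
def upperPos (x : StringCrossing n) : Fin n :=
  ⟨x.level.1 + 1, Nat.add_lt_of_lt_sub x.level.2⟩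

/-- The order of the strings of colour `c` (from positions to labels) on a vertical line to the
right of the crossings in the list `u` and to the left of all the others. Crossings are listed from
left to right. -/
def order (c : StringColor) (u : List (StringCrossing n)) : Equiv.Perm (Fin n) :=
  u.foldl
    (fun σ x => if x.color = c then σ * Equiv.swap x.lowerPos x.upperPos else σ)
    (c.leftOrder n)

/-- The labels of the strings of colour `c` that pass below the chamber which, on the vertical line
just after the crossings in `u`, lies directly above the strings in position `k`. -/
def labelsBelow (c : StringColor) (u : List (StringCrossing n)) (k : Fin n) : Finset (Fin n) :=
  (Finset.Iic k).map (order c u).toEmbedding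

/-- The unordered pair of labels of the strings that meet at the crossing `x`, when `u` lists the
crossings to the left of `x`. -/
def crossingPair (u : List (StringCrossing n)) (x : StringCrossing n) : Sym2 (Fin n) :=
  s(order x.color u x.lowerPos, order x.color u x.upperPos)

theorem card_labelsBelow_eq (u : List (StringCrossing n)) (k : Fin n) :
    (labelsBelow .red u k).card = (labelsBelow .blue u k).card := by
  simp [labelsBelow]

end StringCrossing

/-- An index of a minor of an `n × n` matrix: a set of rows and a set of columns of the same size.
These pairs are also the chamber labels (red labels, blue labels) of double wiring diagrams. -/
@[ext]
structure MinorIndex (n : ℕ) where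
  rows : Finset (Fin n)
  cols : Finset (Fin n)
  card_eq : rows.card = cols.card

/-- The minor of `M` with the rows and the columns prescribed by `D`, in increasing order. -/
def Matrix.minorAt {n : ℕ} {R : Type*} [CommRing R] (M : Matrix (Fin n) (Fin n) R)
    (D : MinorIndex n) : R :=
  (M.submatrix (D.rows.orderEmbOfFin rfl) (D.cols.orderEmbOfFin D.card_eq.symm)).det

/-- A double wiring diagram with `n` strings of each colour, given by its sequence of crossings from
left to right: any two distinct strings of the same colour cross exactly once. -/
structure DoubleWiringDiagram (n : ℕ) where
  crossings : List (StringCrossing n)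
  crosses_once : ∀ (c : StringColor) (a b : Fin n), a ≠ b →
    ∃! t : Fin crossings.length, (crossings.get t).color = c ∧
      StringCrossing.crossingPair (crossings.take t) (crossings.get t) = s(a, b)

namespace DoubleWiringDiagram

variable {n : ℕ}

/-- The set of all chamber labels of a double wiring diagram. Each chamber meets a vertical line just
after some initial part `u` of the sequence of crossings, where it lies directly above the strings
in some position `k`. The chamber above all strings is included, the region below all of them (with
empty labels) is not. -/
def chamberLabels (w : DoubleWiringDiagram n) : Set (MinorIndex n) :=
  {D | ∃ u : List (StringCrossing n), u <+: w.crossings ∧ ∃ k : Fin n,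
    D = ⟨StringCrossing.labelsBelow .red u k, StringCrossing.labelsBelow .blue u k,
      StringCrossing.card_labelsBelow_eq u k⟩}

/-- Two double wiring diagrams are isotopic if they have the same collection of chamber labels. -/
def isotopySetoid (n : ℕ) : Setoid (DoubleWiringDiagram n) :=
  Setoid.ker chamberLabels

end DoubleWiringDiagram

/-- Commutation classes of double wiring diagrams with `n` strings of each colour. -/
def CommutationClass (n : ℕ) : Type :=
  Quotient (DoubleWiringDiagram.isotopySetoid n)

/-- The chamber labels of (any double wiring diagram in) a commutation class. -/
def CommutationClass.chamberLabels {n : ℕ} (w : CommutationClass n) : Set (MinorIndex n) :=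
  Quotient.lift DoubleWiringDiagram.chamberLabels (fun _ _ h => h) w

/-- Laurent polynomials with integer coefficients in variables indexed by `σ`. -/
abbrev MvLaurent (σ : Type*) : Type _ :=
  AddMonoidAlgebra ℤ (σ →₀ ℤ)

namespace MvLaurent

variable {σ : Type*}

/-- All the coefficients of the monomials that occur in `f` are positive. -/
def HasPositiveCoeffs (f : MvLaurent σ) : Prop :=
  ∀ m ∈ f.coeff.support, 0 < f.coeff m

/-- The value of a Laurent polynomial at a point (of interest only at points whose coordinates are
all nonzero). -/
def evalAt {K : Type*} [Field K] (x : σ → K) (f : MvLaurent σ) : K :=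
  f.coeff.sum fun m a => (a : K) * m.prod fun i e => x i ^ e

end MvLaurent

-- For `n ≤ 4` every minor of an `n × n` matrix is a Plücker coordinate of a configuration of eight
-- vectors in dimension four: border the matrix by an identity block to size 4 and append the four
-- unit vectors in reverse order with suitable signs. The minor with rows `I` and columns `J` is the
-- determinant of the columns in `J`, the bordering columns and the unit vectors of the rows outside
-- `I` (`paddedCoordinate_code`). A minor thus becomes a set of four places out of eight, coded as a
-- number below 256, and relations between minors can be moved around by the symmetries of an
-- octagon.
--
-- Functions that are positive Laurent polynomials in the chamber minors are closed under sums,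
-- products and division by chamber minors. A subtraction-free identity `divisor * target = sum of
-- products` therefore yields its target as soon as the divisor is a chamber minor and all factors
-- on the right are already known (`IsPositiveLaurent.of_mul_eq`). The identities used are the
-- three-term Plücker relations (`IsPlucker.three_term`) and the images of a short list of further
-- relations under the symmetries (`IsPlucker.holds_basicRelations`). The latter pass through
-- auxiliary functions `p a * p b - p c * p d`, which are treated as unknowns of their own: they
-- turn out to be positive although they are written as differences.
--
-- What remains is finite. Independent neighbouring crossings can be exchanged without creating
-- chambers, so every diagram gives a word in normal form whose chambers are among its own
-- (`exists_inOrder`). An exhaustive search lists the chamber sets of such words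
-- (`exists_mem_searchFrom`), and a computation with soundness proof `mem_unresolved` confirms that
-- from each of them the relations lead to all minors (`exceptionalSets_eq_nil`). The identities
-- hold over every field, so the resulting Laurent polynomial does not depend on the field or on the
-- matrix.

universe u

/-! ### Arithmetic and evaluation of Laurent polynomials with positive coefficients -/

namespace MvLaurent

variable {σ : Type*}

theorem hasPositiveCoeffs_iff (f : MvLaurent σ) :
    f.HasPositiveCoeffs ↔ ∀ m, 0 ≤ f.coeff m := by
  constructor
  · intro h m
    by_cases hm : m ∈ f.coeff.support
    · exact (h m hm).le
    · simp [Finsupp.notMem_support_iff.mp hm]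
  · intro h m hm
    exact lt_of_le_of_ne (h m) (Ne.symm (Finsupp.mem_support_iff.mp hm))

theorem HasPositiveCoeffs.add {f g : MvLaurent σ} (hf : f.HasPositiveCoeffs)
    (hg : g.HasPositiveCoeffs) : (f + g).HasPositiveCoeffs := by
  rw [hasPositiveCoeffs_iff] at *
  intro m
  exact add_nonneg (hf m) (hg m)

theorem HasPositiveCoeffs.mul {f g : MvLaurent σ} (hf : f.HasPositiveCoeffs)
    (hg : g.HasPositiveCoeffs) : (f * g).HasPositiveCoeffs := by
  classical
  rw [hasPositiveCoeffs_iff] at *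
  intro m
  rw [AddMonoidAlgebra.coeff_mul]
  refine Finset.sum_nonneg fun a _ => Finset.sum_nonneg fun b _ => ?_
  dsimp only
  split_ifs
  · exact mul_nonneg (hf a) (hg b)
  · exact le_rfl

theorem hasPositiveCoeffs_single (m : σ →₀ ℤ) :
    HasPositiveCoeffs (AddMonoidAlgebra.single m 1 : MvLaurent σ) := by
  classical
  rw [hasPositiveCoeffs_iff]
  intro k
  rw [AddMonoidAlgebra.coeff_single, Finsupp.single_apply]
  split_ifs <;> simp

section Eval

variable {K : Type*} [Field K]

/-- The value of a Laurent monomial at a point with nonzero coordinates, as a monoid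
homomorphism. -/
def monomialValue (x : σ → K) (hx : ∀ i, x i ≠ 0) : Multiplicative (σ →₀ ℤ) →* K where
  toFun m := (Multiplicative.toAdd m).prod fun i e => x i ^ e
  map_one' := Finsupp.prod_zero_index
  map_mul' _ _ := Finsupp.prod_add_index' (fun _ => zpow_zero _)
    (fun i _ _ => zpow_add₀ (hx i) _ _)

/-- Evaluation of Laurent polynomials at a point with nonzero coordinates, as a ring
homomorphism. -/
noncomputable def evalHom (x : σ → K) (hx : ∀ i, x i ≠ 0) : MvLaurent σ →+* K :=
  AddMonoidAlgebra.liftNCRingHom (Int.castRingHom K) (monomialValue x hx)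
    (fun _ _ => Commute.all _ _)

theorem evalAt_add (x : σ → K) (hx : ∀ i, x i ≠ 0) (f g : MvLaurent σ) :
    (f + g).evalAt x = f.evalAt x + g.evalAt x :=
  map_add (evalHom x hx) f g

theorem evalAt_mul (x : σ → K) (hx : ∀ i, x i ≠ 0) (f g : MvLaurent σ) :
    (f * g).evalAt x = f.evalAt x * g.evalAt x :=
  map_mul (evalHom x hx) f g

theorem evalAt_single (x : σ → K) (m : σ →₀ ℤ) :
    evalAt x (AddMonoidAlgebra.single m 1) = m.prod fun i e => x i ^ e := by
  simp [evalAt]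

end Eval

end MvLaurent

/-! ### Functions of a matrix that are positive Laurent polynomials in given minors -/

/-- A quantity attached to every `n × n` matrix over every field. -/
abbrev MatrixFunction (n : ℕ) : Type _ :=
  ∀ (K : Type u) [Field K], Matrix (Fin n) (Fin n) K → K

/-- The function `φ` of a matrix is a Laurent polynomial with positive coefficients in the minors
with index in `L`, on matrices for which these minors do not vanish. -/
def IsPositiveLaurent {n : ℕ} (L : Set (MinorIndex n)) (φ : MatrixFunction.{u} n) : Prop :=
  ∃ f : MvLaurent L, f.HasPositiveCoeffs ∧
    ∀ (K : Type u) [Field K] (M : Matrix (Fin n) (Fin n) K),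
      (∀ C ∈ L, M.minorAt C ≠ 0) → φ K M = f.evalAt (fun C => M.minorAt C.1)

/-- The function `φ` of a matrix is a unit up to positive Laurent polynomials in the minors with
index in `L`. -/
def IsPositiveLaurentUnit {n : ℕ} (L : Set (MinorIndex n)) (φ : MatrixFunction.{u} n) : Prop :=
  IsPositiveLaurent L φ ∧ IsPositiveLaurent L (fun K _ M => (φ K M)⁻¹) ∧
    ∀ (K : Type u) [Field K] (M : Matrix (Fin n) (Fin n) K),
      (∀ C ∈ L, M.minorAt C ≠ 0) → φ K M ≠ 0

namespace IsPositiveLaurent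

variable {n : ℕ} {L : Set (MinorIndex n)} {φ ψ : MatrixFunction.{u} n}

theorem congr (h : IsPositiveLaurent L φ)
    (e : ∀ (K : Type u) [Field K] (M : Matrix (Fin n) (Fin n) K),
      (∀ C ∈ L, M.minorAt C ≠ 0) → ψ K M = φ K M) : IsPositiveLaurent L ψ := by
  obtain ⟨f, hf, hv⟩ := h
  exact ⟨f, hf, fun K _ M hM => (e K M hM).trans (hv K M hM)⟩

theorem one : IsPositiveLaurent L (fun _ _ _ => 1 : MatrixFunction.{u} n) := by
  refine ⟨AddMonoidAlgebra.single 0 1, MvLaurent.hasPositiveCoeffs_single 0, fun K _ M _ => ?_⟩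
  exact (MvLaurent.evalAt_single _ 0).symm

theorem zero : IsPositiveLaurent L (fun _ _ _ => 0 : MatrixFunction.{u} n) :=
  ⟨0, by simp [MvLaurent.HasPositiveCoeffs], fun K _ M _ => by simp [MvLaurent.evalAt]⟩

theorem add (hφ : IsPositiveLaurent L φ) (hψ : IsPositiveLaurent L ψ) :
    IsPositiveLaurent L (fun K _ M => φ K M + ψ K M) := by
  obtain ⟨f, hf, hfv⟩ := hφ
  obtain ⟨g, hg, hgv⟩ := hψ
  refine ⟨f + g, hf.add hg, fun K _ M hM => ?_⟩
  have e := MvLaurent.evalAt_add (fun C : L => M.minorAt C.1) (fun C => hM C.1 C.2) f g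
  rw [e, ← hfv K M hM, ← hgv K M hM]

theorem mul (hφ : IsPositiveLaurent L φ) (hψ : IsPositiveLaurent L ψ) :
    IsPositiveLaurent L (fun K _ M => φ K M * ψ K M) := by
  obtain ⟨f, hf, hfv⟩ := hφ
  obtain ⟨g, hg, hgv⟩ := hψ
  refine ⟨f * g, hf.mul hg, fun K _ M hM => ?_⟩
  have e := MvLaurent.evalAt_mul (fun C : L => M.minorAt C.1) (fun C => hM C.1 C.2) f g
  rw [e, ← hfv K M hM, ← hgv K M hM]

theorem list_prod {α : Type*} {F : α → MatrixFunction.{u} n} {l : List α}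
    (h : ∀ a ∈ l, IsPositiveLaurent L (F a)) :
    IsPositiveLaurent L (fun K _ M => (l.map fun a => F a K M).prod) := by
  induction l with
  | nil => exact one
  | cons a l ih =>
    rw [List.forall_mem_cons] at h
    exact (h.1.mul (ih h.2)).congr fun K _ M _ => by rw [List.map_cons, List.prod_cons]

theorem list_sum {α : Type*} {F : α → MatrixFunction.{u} n} {l : List α}
    (h : ∀ a ∈ l, IsPositiveLaurent L (F a)) :
    IsPositiveLaurent L (fun K _ M => (l.map fun a => F a K M).sum) := by
  induction l with
  | nil => exact zero
  | cons a l ih =>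
    rw [List.forall_mem_cons] at h
    exact (h.1.add (ih h.2)).congr fun K _ M _ => by rw [List.map_cons, List.sum_cons]

/-- The one inference that leads to new functions: a subtraction-free expression stays positive when
it is divided by a unit. -/
theorem of_mul_eq (hφ : IsPositiveLaurentUnit L φ) {χ : MatrixFunction.{u} n}
    (hχ : IsPositiveLaurent L χ)
    (e : ∀ (K : Type u) [Field K] (M : Matrix (Fin n) (Fin n) K), φ K M * ψ K M = χ K M) :
    IsPositiveLaurent L ψ := by
  refine (hφ.2.1.mul hχ).congr fun K _ M hM => ?_
  rw [← e, inv_mul_cancel_left₀ (hφ.2.2 K M hM)]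

end IsPositiveLaurent

namespace IsPositiveLaurentUnit

variable {n : ℕ} {L : Set (MinorIndex n)}

/-- Needed for the empty minor, whose region below all strings is not counted as a chamber. -/
theorem of_eq_one {φ : MatrixFunction.{u} n}
    (e : ∀ (K : Type u) [Field K] (M : Matrix (Fin n) (Fin n) K), φ K M = 1) :
    IsPositiveLaurentUnit L φ := by
  refine ⟨IsPositiveLaurent.one.congr fun K _ M _ => e K M,
    IsPositiveLaurent.one.congr fun K _ M _ => ?_, fun K _ M _ => ?_⟩
  · rw [e, inv_one]
  · rw [e]; exact one_ne_zero

theorem of_mem {φ : MatrixFunction.{u} n} {D : MinorIndex n} (hD : D ∈ L)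
    (e : ∀ (K : Type u) [Field K] (M : Matrix (Fin n) (Fin n) K), φ K M = M.minorAt D) :
    IsPositiveLaurentUnit L φ := by
  refine ⟨⟨AddMonoidAlgebra.single (Finsupp.single ⟨D, hD⟩ 1) 1,
      MvLaurent.hasPositiveCoeffs_single _, fun K _ M hM => ?_⟩,
    ⟨AddMonoidAlgebra.single (Finsupp.single ⟨D, hD⟩ (-1)) 1,
      MvLaurent.hasPositiveCoeffs_single _, fun K _ M hM => ?_⟩, fun K _ M hM => ?_⟩
  · refine (e K M).trans (Eq.trans ?_ (MvLaurent.evalAt_single _ _).symm)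
    rw [Finsupp.prod_single_index (zpow_zero _), zpow_one]
  · refine (congrArg _ (e K M)).trans (Eq.trans ?_ (MvLaurent.evalAt_single _ _).symm)
    rw [Finsupp.prod_single_index (zpow_zero _), zpow_neg_one]
  · rw [e]; exact hM D hD

end IsPositiveLaurentUnit

/-! ### Words of crossings and the chambers that they meet -/

namespace StringCrossing

variable {n : ℕ}

theorem lowerPos_val (x : StringCrossing n) : x.lowerPos.val = x.level.val := rfl

theorem upperPos_val (x : StringCrossing n) : x.upperPos.val = x.level.val + 1 := rfl

/-- The orders of the strings of both colours on a vertical line. -/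
abbrev Orders (n : ℕ) : Type := StringColor → Equiv.Perm (Fin n)

/-- The orders of the strings just after the crossing `x`, given those just before. -/
def cross (s : Orders n) (x : StringCrossing n) : Orders n := fun c =>
  if x.color = c then s c * Equiv.swap x.lowerPos x.upperPos else s c

/-- The crossing `x` is the first one of the two strings that meet there. -/
def IsLegal (s : Orders n) (x : StringCrossing n) : Prop :=
  (x.color.leftOrder n)⁻¹ (s x.color x.lowerPos) < (x.color.leftOrder n)⁻¹ (s x.color x.upperPos)

/-- Starting from the orders `s`, the word `w` of crossings only has crossings of strings that
have not met before, and cannot be continued. -/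
def IsComplete (s : Orders n) : List (StringCrossing n) → Prop
  | [] => ∀ x, ¬ IsLegal s x
  | x :: w => IsLegal s x ∧ IsComplete (cross s x) w

/-- The labels of the strings below position `k` (counted from `0`), for one colour. -/
def below (σ : Equiv.Perm (Fin n)) (k : ℕ) : Finset (Fin n) :=
  (Finset.univ.filter fun p : Fin n => p.val < k).map σ.toEmbedding

theorem card_below_eq (σ τ : Equiv.Perm (Fin n)) (k : ℕ) :
    (below σ k).card = (below τ k).card := by
  simp [below]

/-- The label of the chamber above `k` strings of each colour. -/
def chamberAt (s : Orders n) (k : ℕ) : MinorIndex n :=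
  ⟨below (s .red) k, below (s .blue) k, card_below_eq _ _ k⟩

/-- The labels of the chambers that are met by the word `w` when it starts from `s`. -/
def chambers (s : Orders n) : List (StringCrossing n) → Set (MinorIndex n)
  | [] => {D | ∃ k < n, D = chamberAt s (k + 1)}
  | x :: w => {D | ∃ k < n, D = chamberAt s (k + 1)} ∪ chambers (cross s x) w

theorem labelsBelow_eq (c : StringColor) (u : List (StringCrossing n)) (k : Fin n) :
    labelsBelow c u k = below (order c u) (k.val + 1) := by
  have h : Finset.Iic k = Finset.univ.filter fun p : Fin n => p.val < k.val + 1 := by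
    ext p
    rw [Finset.mem_Iic, Finset.mem_filter, Fin.le_def]
    exact ⟨fun h => ⟨Finset.mem_univ _, by omega⟩, fun h => by omega⟩
  rw [labelsBelow, h, below]

theorem foldl_cross (c : StringColor) (u : List (StringCrossing n)) (s : Orders n) :
    u.foldl cross s c = u.foldl
      (fun σ x => if x.color = c then σ * Equiv.swap x.lowerPos x.upperPos else σ) (s c) := by
  induction u generalizing s with
  | nil => rfl
  | cons x u ih => exact ih (cross s x)

/-- The orders at the left end. -/
def leftOrders (n : ℕ) : Orders n := fun c => c.leftOrder n

theorem order_eq (c : StringColor) (u : List (StringCrossing n)) :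
    order c u = u.foldl cross (leftOrders n) c :=
  (foldl_cross c u (leftOrders n)).symm

/-- One inclusion is enough: if some of the chamber minors already suffice to express a minor, then
all of them do. -/
theorem chambers_foldl_subset (w : DoubleWiringDiagram n) (u v : List (StringCrossing n))
    (h : w.crossings = u ++ v) :
    chambers (u.foldl cross (leftOrders n)) v ⊆ w.chamberLabels := by
  have key : {D | ∃ k < n, D = chamberAt (u.foldl cross (leftOrders n)) (k + 1)} ⊆
      w.chamberLabels := by
    rintro D ⟨k, hk, rfl⟩
    refine ⟨u, ⟨v, h.symm⟩, ⟨k, hk⟩, ?_⟩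
    ext1
    · exact ((labelsBelow_eq _ u ⟨k, hk⟩).trans (by rw [order_eq]; rfl)).symm
    · exact ((labelsBelow_eq _ u ⟨k, hk⟩).trans (by rw [order_eq]; rfl)).symm
  induction v generalizing u with
  | nil => exact key
  | cons x v ih =>
    have h' : w.crossings = (u ++ [x]) ++ v := by simpa using h
    refine Set.union_subset key ?_
    have := ih (u ++ [x]) h' ?_
    · rwa [List.foldl_append] at this
    · rintro D ⟨k, hk, rfl⟩
      refine ⟨u ++ [x], ⟨v, h'.symm⟩, ⟨k, hk⟩, ?_⟩
      ext1
      · exact ((labelsBelow_eq _ (u ++ [x]) ⟨k, hk⟩).trans (by rw [order_eq]; rfl)).symm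
      · exact ((labelsBelow_eq _ (u ++ [x]) ⟨k, hk⟩).trans (by rw [order_eq]; rfl)).symm

/-! ### Crossings that commute -/

/-- The two exchanged positions lie on the same side of every cut except the one between them. -/
theorem below_mul_swap (σ : Equiv.Perm (Fin n)) (x : StringCrossing n) {k : ℕ}
    (hk : k ≠ x.level.val + 1) :
    below (σ * Equiv.swap x.lowerPos x.upperPos) k = below σ k := by
  have hl := x.lowerPos_val
  have hu := x.upperPos_val
  ext a
  simp only [below, Finset.mem_map, Finset.mem_filter, Finset.mem_univ, true_and,
    Equiv.coe_toEmbedding, Equiv.Perm.mul_apply]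
  constructor
  · rintro ⟨p, hp, rfl⟩
    refine ⟨_, ?_, rfl⟩
    rw [Equiv.swap_apply_def]
    split_ifs with h1 h2 <;> first | subst h1 | subst h2 | skip
    all_goals omega
  · rintro ⟨p, hp, rfl⟩
    refine ⟨Equiv.swap x.lowerPos x.upperPos p, ?_, by rw [Equiv.swap_apply_self]⟩
    rw [Equiv.swap_apply_def]
    split_ifs with h1 h2 <;> first | subst h1 | subst h2 | skip
    all_goals omega

theorem below_cross (s : Orders n) (x : StringCrossing n) (c : StringColor) {k : ℕ}
    (hk : k ≠ x.level.val + 1) : below (cross s x c) k = below (s c) k := by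
  unfold cross
  split_ifs
  · exact below_mul_swap _ _ hk
  · rfl

theorem chamberAt_cross (s : Orders n) (x : StringCrossing n) {k : ℕ}
    (hk : k ≠ x.level.val + 1) : chamberAt (cross s x) k = chamberAt s k :=
  MinorIndex.ext (below_cross s x .red hk) (below_cross s x .blue hk)

/-- The crossings `x` and `y` are independent of each other. -/
def Commutes (x y : StringCrossing n) : Prop :=
  x.level ≠ y.level ∧
    (x.color = y.color → x.level.val + 1 ≠ y.level.val ∧ y.level.val + 1 ≠ x.level.val)

theorem Commutes.symm {x y : StringCrossing n} (h : Commutes x y) : Commutes y x :=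
  ⟨h.1.symm, fun e => (h.2 e.symm).symm⟩

theorem Commutes.disjoint {x y : StringCrossing n} (h : Commutes x y) (e : x.color = y.color) :
    x.lowerPos ≠ y.lowerPos ∧ x.lowerPos ≠ y.upperPos ∧ x.upperPos ≠ y.lowerPos ∧
      x.upperPos ≠ y.upperPos := by
  have h1 : x.level.val ≠ y.level.val := fun h' => h.1 (Fin.ext h')
  have h2 := h.2 e
  simp only [ne_eq, Fin.ext_iff, lowerPos_val, upperPos_val]
  omega

theorem Commutes.cross_cross {x y : StringCrossing n} (h : Commutes x y) (s : Orders n) :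
    cross (cross s x) y = cross (cross s y) x := by
  funext c
  unfold cross
  split_ifs with h1 h2 h2 <;> try rfl
  obtain ⟨a1, a2, a3, a4⟩ := h.disjoint (h2.trans h1.symm)
  rw [mul_assoc, mul_assoc]
  congr 1
  exact (Equiv.Perm.Disjoint.commute (Equiv.Perm.disjoint_iff_disjoint_support.mpr (by
    have e1 : x.lowerPos ≠ x.upperPos := by
      simp [Fin.ext_iff, lowerPos_val, upperPos_val]
    have e2 : y.lowerPos ≠ y.upperPos := by
      simp [Fin.ext_iff, lowerPos_val, upperPos_val]
    rw [Equiv.Perm.support_swap e1, Equiv.Perm.support_swap e2]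
    simp [a1.symm, a2.symm, a3.symm, a4.symm]))).eq

theorem Commutes.isLegal_cross {x y : StringCrossing n} (h : Commutes x y) (s : Orders n) :
    IsLegal (cross s x) y ↔ IsLegal s y := by
  unfold IsLegal cross
  split_ifs with e
  · obtain ⟨a1, a2, a3, a4⟩ := h.disjoint e
    rw [Equiv.Perm.mul_apply, Equiv.Perm.mul_apply,
      Equiv.swap_apply_of_ne_of_ne a1.symm a3.symm, Equiv.swap_apply_of_ne_of_ne a2.symm a4.symm]
  · rfl

theorem Commutes.isComplete_swap {x y : StringCrossing n} (h : Commutes x y)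
    (u v : List (StringCrossing n)) (s : Orders n) (hw : IsComplete s (u ++ x :: y :: v)) :
    IsComplete s (u ++ y :: x :: v) := by
  induction u generalizing s with
  | nil =>
    obtain ⟨h1, h2, h3⟩ := hw
    exact ⟨(h.isLegal_cross s).mp h2, (h.symm.isLegal_cross s).mpr h1, h.cross_cross s ▸ h3⟩
  | cons z u ih => exact ⟨hw.1, ih _ hw.2⟩

theorem chamberAt_mem_chambers (s : Orders n) (w : List (StringCrossing n)) {k : ℕ} (hk : k < n) :
    chamberAt s (k + 1) ∈ chambers s w := by
  cases w with
  | nil => exact ⟨k, hk, rfl⟩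
  | cons x w => exact Or.inl ⟨k, hk, rfl⟩

/-- Commuting crossings have different levels, so they change chambers at different heights. On the
line between the two, every chamber is one that is also met before both or after both. -/
theorem Commutes.chambers_swap {x y : StringCrossing n} (h : Commutes x y)
    (u v : List (StringCrossing n)) (s : Orders n) :
    chambers s (u ++ y :: x :: v) ⊆ chambers s (u ++ x :: y :: v) := by
  induction u generalizing s with
  | nil =>
    rintro D (hD | ⟨k, hk, rfl⟩ | hD)
    · exact Or.inl hD
    · by_cases e : k + 1 = y.level.val + 1
      · rw [← chamberAt_cross (cross s y) x (fun e' => h.1 (Fin.ext (by omega))),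
          ← h.cross_cross]
        exact Or.inr (Or.inr (chamberAt_mem_chambers _ _ hk))
      · rw [chamberAt_cross s y e]
        exact Or.inl ⟨k, hk, rfl⟩
    · rw [← h.cross_cross] at hD
      exact Or.inr (Or.inr hD)
  | cons z u ih =>
    rintro D (hD | hD)
    · exact Or.inl hD
    · exact Or.inr (ih _ hD)

/-- The order of two consecutive crossings in normal form. -/
def InOrder (x y : StringCrossing n) : Prop :=
  x.level.val ≤ y.level.val ∨ (x.color = y.color ∧ x.level.val ≤ y.level.val + 1)

/-- Out of order means that the level drops, and by at least two if the colours agree. Such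
neighbours touch disjoint pairs of strings and different chambers, so a word that fails to be a
chain can always be sorted further. -/
theorem commutes_of_not_inOrder {x y : StringCrossing n} (h : ¬ InOrder x y) : Commutes x y := by
  unfold InOrder at h
  push Not at h
  refine ⟨fun e => ?_, fun e => ?_⟩
  · exact absurd h.1 (by simp [e])
  · have := h.2 e
    omega

/-- The sum of the levels, weighted by the distances from the right end. -/
def weight : List (StringCrossing n) → ℕ
  | [] => 0
  | x :: w => x.level.val * (w.length + 1) + weight w

theorem weight_swap_lt {x y : StringCrossing n} (h : y.level.val < x.level.val)
    (u v : List (StringCrossing n)) :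
    weight (u ++ y :: x :: v) < weight (u ++ x :: y :: v) := by
  induction u with
  | nil => simp only [List.nil_append, weight, List.length_cons]; nlinarith
  | cons z u ih => simpa [weight] using ih

/-- Bubble sort: exchange neighbours that are out of order. The smaller level moves to the left,
where its factor is larger, so the weight drops and the process ends. -/
theorem exists_inOrder (s : Orders n) (w : List (StringCrossing n)) (hw : IsComplete s w) :
    ∃ w', IsComplete s w' ∧ w'.IsChain InOrder ∧ chambers s w' ⊆ chambers s w := by
  induction hk : weight w using Nat.strong_induction_on generalizing w with
  | _ k ih =>
    by_cases hc : w.IsChain InOrder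
    · exact ⟨w, hw, hc, subset_rfl⟩
    · rw [List.isChain_iff_forall_rel_of_append_cons_cons] at hc
      push Not at hc
      obtain ⟨x, y, u, v, rfl, hxy⟩ := hc
      have hcomm := commutes_of_not_inOrder hxy
      have hlt : y.level.val < x.level.val := by
        unfold InOrder at hxy
        omega
      obtain ⟨w', h1, h2, h3⟩ := ih _ (hk ▸ weight_swap_lt hlt u v) (u ++ y :: x :: v)
        (hcomm.isComplete_swap u v s hw) rfl
      exact ⟨w', h1, h2, h3.trans (hcomm.chambers_swap u v s)⟩

/-! ### The words of double wiring diagrams -/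

/-- The string `a` of colour `c` runs below the string `b` of this colour. -/
def RunsBelow (s : Orders n) (c : StringColor) (a b : Fin n) : Prop :=
  (s c)⁻¹ a < (s c)⁻¹ b

theorem perm_inv_apply (σ : Equiv.Perm (Fin n)) (p : Fin n) : σ⁻¹ (σ p) = p :=
  Equiv.symm_apply_apply σ p

theorem runsBelow_cross_of_ne {s : Orders n} {c : StringColor} {a b : Fin n} (hab : a ≠ b)
    {x : StringCrossing n}
    (h : ¬ (x.color = c ∧ s(s x.color x.lowerPos, s x.color x.upperPos) = s(a, b))) :
    RunsBelow (cross s x) c a b ↔ RunsBelow s c a b := by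
  unfold RunsBelow cross
  split_ifs with e
  · subst e
    have hl := x.lowerPos_val
    have hu := x.upperPos_val
    obtain ⟨p, rfl⟩ := (s x.color).surjective a
    obtain ⟨q, rfl⟩ := (s x.color).surjective b
    have hpq : p ≠ q := fun e => hab (e ▸ rfl)
    simp only [Sym2.eq_iff, EmbeddingLike.apply_eq_iff_eq, true_and, not_or, not_and] at h
    simp only [mul_inv_rev, Equiv.swap_inv, Equiv.Perm.mul_apply, perm_inv_apply,
      Equiv.swap_apply_def]
    simp only [Fin.ext_iff, Fin.lt_def, ne_eq] at *
    split_ifs <;> omega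
  · rfl

theorem runsBelow_cross_of_eq {s : Orders n} {c : StringColor} {a b : Fin n}
    {x : StringCrossing n}
    (h : x.color = c ∧ s(s x.color x.lowerPos, s x.color x.upperPos) = s(a, b)) :
    RunsBelow (cross s x) c a b ↔ ¬ RunsBelow s c a b := by
  obtain ⟨rfl, h⟩ := h
  have hl := x.lowerPos_val
  have hu := x.upperPos_val
  unfold RunsBelow cross
  rw [if_pos rfl]
  rcases Sym2.eq_iff.mp h with ⟨rfl, rfl⟩ | ⟨rfl, rfl⟩ <;>
    simp only [mul_inv_rev, Equiv.swap_inv, Equiv.Perm.mul_apply, perm_inv_apply,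
      Equiv.swap_apply_left, Equiv.swap_apply_right] <;>
    rw [Fin.lt_def, Fin.lt_def] <;> omega

theorem runsBelow_foldl {c : StringColor} {a b : Fin n} (hab : a ≠ b)
    (v : List (StringCrossing n)) (s : Orders n)
    (h : ∀ v₁ x v₂, v = v₁ ++ x :: v₂ → ¬ (x.color = c ∧
      s(v₁.foldl cross s x.color x.lowerPos, v₁.foldl cross s x.color x.upperPos) = s(a, b))) :
    RunsBelow (v.foldl cross s) c a b ↔ RunsBelow s c a b := by
  induction v generalizing s with
  | nil => rfl
  | cons x v ih =>
    rw [List.foldl_cons, ih (cross s x) fun v₁ y v₂ e => ?_]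
    · exact runsBelow_cross_of_ne hab (h [] x v rfl)
    · exact h (x :: v₁) y v₂ (by rw [e]; rfl)

end StringCrossing

namespace DoubleWiringDiagram

open StringCrossing

variable {n : ℕ} (w : DoubleWiringDiagram n)

/-- The strings `a` and `b` of colour `c` meet at the crossing `x` that comes after `u`. -/
abbrev MeetAt (c : StringColor) (a b : Fin n) (u : List (StringCrossing n))
    (x : StringCrossing n) : Prop :=
  x.color = c ∧ s(u.foldl cross (leftOrders n) x.color x.lowerPos,
    u.foldl cross (leftOrders n) x.color x.upperPos) = s(a, b)

theorem exists_meetAt (c : StringColor) {a b : Fin n} (hab : a ≠ b) :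
    ∃ u x v, w.crossings = u ++ x :: v ∧ MeetAt c a b u x := by
  obtain ⟨t, ⟨h1, h2⟩, -⟩ := w.crosses_once c a b hab
  refine ⟨w.crossings.take t, w.crossings.get t, w.crossings.drop (t + 1), by simp, h1, ?_⟩
  rw [← order_eq]
  exact h2

theorem length_eq_of_meetAt {c : StringColor} {a b : Fin n} (hab : a ≠ b)
    {u v u' v' : List (StringCrossing n)} {x x' : StringCrossing n}
    (h : w.crossings = u ++ x :: v) (hx : MeetAt c a b u x)
    (h' : w.crossings = u' ++ x' :: v') (hx' : MeetAt c a b u' x') :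
    u.length = u'.length := by
  obtain ⟨t, -, ht⟩ := w.crosses_once c a b hab
  have key : ∀ (u v : List (StringCrossing n)) (x : StringCrossing n),
      w.crossings = u ++ x :: v → MeetAt c a b u x → u.length = t.val := by
    intro u v x h hx
    have hlt : u.length < w.crossings.length := by rw [h]; simp
    have e1 : w.crossings.get ⟨u.length, hlt⟩ = x := by simp [h]
    have e2 : w.crossings.take u.length = u := by rw [h]; simp
    have := ht ⟨u.length, hlt⟩ (by
      dsimp only
      rw [e1, e2]
      refine ⟨hx.1, ?_⟩
      unfold crossingPair
      rw [order_eq]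
      exact hx.2)
    exact congrArg Fin.val this
  rw [key u v x h hx, key u' v' x' h' hx']

/-- Two strings of the same colour keep their order from the left end until they meet and have the
opposite order ever after, since they meet only once. So every crossing is a first meeting, and at
the right end no neighbours are left that have yet to meet. -/
theorem isComplete_foldl (u v : List (StringCrossing n)) (h : w.crossings = u ++ v) :
    IsComplete (u.foldl cross (leftOrders n)) v := by
  induction v generalizing u with
  | nil =>
    intro x hx
    set a := u.foldl cross (leftOrders n) x.color x.lowerPos with ha
    set b := u.foldl cross (leftOrders n) x.color x.upperPos with hb
    have hlt : x.lowerPos < x.upperPos := by simp [Fin.lt_def, lowerPos_val, upperPos_val]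
    have hab : a ≠ b := fun e => hlt.ne ((Equiv.injective _) e)
    have hend : RunsBelow (u.foldl cross (leftOrders n)) x.color a b := by
      simpa [RunsBelow, ha, hb] using hlt
    obtain ⟨u₁, y, u₂, h1, h2⟩ := w.exists_meetAt x.color hab
    have e1 : RunsBelow (u₁.foldl cross (leftOrders n)) x.color a b ↔
        RunsBelow (leftOrders n) x.color a b := by
      refine runsBelow_foldl hab u₁ _ fun v₁ z v₂ e hz => ?_
      have := w.length_eq_of_meetAt (v := v₂ ++ y :: u₂) hab (by rw [h1, e]; simp) hz h1 h2
      rw [e] at this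
      simp at this
    have e2 := runsBelow_cross_of_eq h2
    have hu : u = u₁ ++ y :: u₂ := by rw [← h1, h, List.append_nil]
    have e3 : RunsBelow (u.foldl cross (leftOrders n)) x.color a b ↔
        RunsBelow (cross (u₁.foldl cross (leftOrders n)) y) x.color a b := by
      conv_lhs => rw [hu, List.foldl_append, List.foldl_cons]
      refine runsBelow_foldl hab u₂ _ fun v₁ z v₂ e hz => ?_
      have := w.length_eq_of_meetAt (u := u₁ ++ y :: v₁) (v := v₂) (x := z) hab
        (by rw [h1, e]; simp) (by simpa [MeetAt, List.foldl_append] using hz) h1 h2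
      simp at this
    exact (e2.mp (e3.mp hend)) (e1.mpr hx)
  | cons x v ih =>
    refine ⟨?_, ?_⟩
    · set a := u.foldl cross (leftOrders n) x.color x.lowerPos with ha
      set b := u.foldl cross (leftOrders n) x.color x.upperPos with hb
      have hlt : x.lowerPos < x.upperPos := by simp [Fin.lt_def, lowerPos_val, upperPos_val]
      have hab : a ≠ b := fun e => hlt.ne ((Equiv.injective _) e)
      have hend : RunsBelow (u.foldl cross (leftOrders n)) x.color a b := by
        simpa [RunsBelow, ha, hb] using hlt
      refine (runsBelow_foldl hab u _ fun v₁ z v₂ e hz => ?_).mp hend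
      have := w.length_eq_of_meetAt (v := v₂ ++ x :: v) hab (by rw [h, e]; simp) hz h ⟨rfl, rfl⟩
      rw [e] at this
      simp at this
    · have := ih (u ++ [x]) (by simpa using h)
      rwa [List.foldl_append] at this

end DoubleWiringDiagram

/-! ### Search for the chamber sets of words in normal form -/

namespace ChamberSearch

/-- Evaluate `f` at `k`, after the evaluation of `k`. -/
def force {α : Type} (k : ℕ) (f : ℕ → α) : α :=
  Nat.rec (f 0) (fun p _ => f (Nat.succ p)) k

theorem force_eq {α : Type} (k : ℕ) (f : ℕ → α) : force k f = f k := by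
  cases k <;> rfl

/-- The number with the binary digits `1` at the places in `l`. -/
def bits (l : List ℕ) : ℕ :=
  l.foldr (fun i m => Nat.lor (Nat.shiftLeft 1 i) m) 0

/-- Insert the place `q + j` in a set of places. -/
def insertBit (C q j : ℕ) : ℕ := Nat.lor C (Nat.shiftLeft 1 (Nat.add q j))

theorem testBit_insertBit {C q j i : ℕ} (h : (insertBit C q j).testBit i) :
    C.testBit i ∨ i = q + j := by
  change (C ||| 1 <<< (q + j)).testBit i = true at h
  rw [Nat.testBit_or, Bool.or_eq_true, Nat.shiftLeft_eq, one_mul, Nat.testBit_two_pow] at h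
  exact h.imp id fun h => (decide_eq_true_iff.mp h).symm

theorem testBit_bits {l : List ℕ} {i : ℕ} : (bits l).testBit i ↔ i ∈ l := by
  induction l with
  | nil => simp [bits]
  | cons a l ih =>
    change ((1 <<< a) ||| bits l).testBit i = true ↔ _
    rw [Nat.testBit_or, Bool.or_eq_true, Nat.shiftLeft_eq, one_mul, Nat.testBit_two_pow,
      decide_eq_true_iff, ih, List.mem_cons, eq_comm]

/-- One branch of the search, for a red crossing. -/
def redMove (ok l a b c : ℕ) (next : ℕ → List ℕ → List ℕ) (acc : List ℕ) : List ℕ :=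
  Bool.rec acc (force (Nat.sub (Nat.add a c) b) fun m =>
    Bool.rec (next m acc) acc (Nat.ble b m)) (Nat.ble ok l)

/-- One branch of the search, for a blue crossing. -/
def blueMove (ok l a b c : ℕ) (next : ℕ → List ℕ → List ℕ) (acc : List ℕ) : List ℕ :=
  Bool.rec acc (force (Nat.sub (Nat.add a c) b) fun m =>
    Bool.rec (next m acc) acc (Nat.ble m b)) (Nat.ble ok l)

/-- There is no crossing of strings that have not met yet. -/
def isStuck (q₀ q₄ j₀ j₄ q₁ q₂ q₃ j₁ j₂ j₃ : ℕ) : Bool :=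
  and (Nat.ble q₁ (Nat.sub (Nat.add q₀ q₂) q₁)) (and (Nat.ble q₂ (Nat.sub (Nat.add q₁ q₃) q₂))
    (and (Nat.ble q₃ (Nat.sub (Nat.add q₂ q₄) q₃)) (and (Nat.ble (Nat.sub (Nat.add j₀ j₂) j₁) j₁)
      (and (Nat.ble (Nat.sub (Nat.add j₁ j₃) j₂) j₂) (Nat.ble (Nat.sub (Nat.add j₂ j₄) j₃) j₃)))))

/-- The chamber sets of the complete words in normal form. The state of the search consists of the
least levels of a next red and a next blue crossing, the codes of the sets of red and of blue labels
below the heights `1`, `2`, `3`, and the set `C` of the codes of the chambers met so far. -/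
noncomputable def search (q₀ q₄ j₀ j₄ : ℕ) (fuel : ℕ) :
    ℕ → ℕ → ℕ → ℕ → ℕ → ℕ → ℕ → ℕ → ℕ → List ℕ → List ℕ :=
  Nat.rec (motive := fun _ => ℕ → ℕ → ℕ → ℕ → ℕ → ℕ → ℕ → ℕ → ℕ → List ℕ → List ℕ)
    -- Without fuel the empty set is returned. Every claim about all elements of a set holds for it,
    -- so soundness needs no bound on the length of words; such an entry would just have to pass the
    -- final check too.
    (fun _ _ _ _ _ _ _ _ _ acc => 0 :: acc)
    (fun _ ih okr okb q₁ q₂ q₃ j₁ j₂ j₃ C acc =>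
      Bool.rec (
        -- After a crossing at level `l`, the normal form admits levels from `l - 1` on for the same
        -- colour and from `l` on for the other.
        redMove okr 0 q₀ q₁ q₂ (fun m => ih 0 0 m q₂ q₃ j₁ j₂ j₃ (insertBit C m j₁)) <|
        redMove okr 1 q₁ q₂ q₃ (fun m => ih 0 1 q₁ m q₃ j₁ j₂ j₃ (insertBit C m j₂)) <|
        redMove okr 2 q₂ q₃ q₄ (fun m => ih 1 2 q₁ q₂ m j₁ j₂ j₃ (insertBit C m j₃)) <|
        blueMove okb 0 j₀ j₁ j₂ (fun m => ih 0 0 q₁ q₂ q₃ m j₂ j₃ (insertBit C q₁ m)) <|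
        blueMove okb 1 j₁ j₂ j₃ (fun m => ih 1 0 q₁ q₂ q₃ j₁ m j₃ (insertBit C q₂ m)) <|
        blueMove okb 2 j₂ j₃ j₄ (fun m => ih 2 1 q₁ q₂ q₃ j₁ j₂ m (insertBit C q₃ m)) acc)
        (C :: acc)
        (isStuck q₀ q₄ j₀ j₄ q₁ q₂ q₃ j₁ j₂ j₃)) fuel

theorem redMove_eq (ok l a b c : ℕ) (next : ℕ → List ℕ → List ℕ) (acc : List ℕ) :
    redMove ok l a b c next acc =
      if ok ≤ l ∧ a + c - b < b then next (a + c - b) acc else acc := by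
  unfold redMove
  rw [force_eq]
  change (Bool.rec acc (Bool.rec (next (a + c - b) acc) acc (Nat.ble b (a + c - b)))
    (Nat.ble ok l) : List ℕ) = _
  cases h₁ : Nat.ble ok l <;> cases h₂ : Nat.ble b (a + c - b) <;>
    simp only [← Bool.not_eq_true, Nat.ble_eq] at h₁ h₂ <;>
    simp [h₁, h₂]

theorem blueMove_eq (ok l a b c : ℕ) (next : ℕ → List ℕ → List ℕ) (acc : List ℕ) :
    blueMove ok l a b c next acc =
      if ok ≤ l ∧ b < a + c - b then next (a + c - b) acc else acc := by
  unfold blueMove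
  rw [force_eq]
  change (Bool.rec acc (Bool.rec (next (a + c - b) acc) acc (Nat.ble (a + c - b) b))
    (Nat.ble ok l) : List ℕ) = _
  cases h₁ : Nat.ble ok l <;> cases h₂ : Nat.ble (a + c - b) b <;>
    simp only [← Bool.not_eq_true, Nat.ble_eq] at h₁ h₂ <;>
    simp [h₁, h₂]

theorem subset_redMove {ok l a b c : ℕ} {next : ℕ → List ℕ → List ℕ}
    (h : ∀ m acc, acc ⊆ next m acc) (acc : List ℕ) : acc ⊆ redMove ok l a b c next acc := by
  rw [redMove_eq]
  split_ifs
  · exact h _ _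
  · exact List.Subset.refl _

theorem subset_blueMove {ok l a b c : ℕ} {next : ℕ → List ℕ → List ℕ}
    (h : ∀ m acc, acc ⊆ next m acc) (acc : List ℕ) : acc ⊆ blueMove ok l a b c next acc := by
  rw [blueMove_eq]
  split_ifs
  · exact h _ _
  · exact List.Subset.refl _

theorem search_succ (q₀ q₄ j₀ j₄ fuel okr okb q₁ q₂ q₃ j₁ j₂ j₃ C : ℕ) (acc : List ℕ) :
    search q₀ q₄ j₀ j₄ (fuel + 1) okr okb q₁ q₂ q₃ j₁ j₂ j₃ C acc =
      if isStuck q₀ q₄ j₀ j₄ q₁ q₂ q₃ j₁ j₂ j₃ then C :: acc else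
        redMove okr 0 q₀ q₁ q₂ (fun m =>
          search q₀ q₄ j₀ j₄ fuel 0 0 m q₂ q₃ j₁ j₂ j₃ (insertBit C m j₁)) <|
        redMove okr 1 q₁ q₂ q₃ (fun m =>
          search q₀ q₄ j₀ j₄ fuel 0 1 q₁ m q₃ j₁ j₂ j₃ (insertBit C m j₂)) <|
        redMove okr 2 q₂ q₃ q₄ (fun m =>
          search q₀ q₄ j₀ j₄ fuel 1 2 q₁ q₂ m j₁ j₂ j₃ (insertBit C m j₃)) <|
        blueMove okb 0 j₀ j₁ j₂ (fun m =>
          search q₀ q₄ j₀ j₄ fuel 0 0 q₁ q₂ q₃ m j₂ j₃ (insertBit C q₁ m)) <|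
        blueMove okb 1 j₁ j₂ j₃ (fun m =>
          search q₀ q₄ j₀ j₄ fuel 1 0 q₁ q₂ q₃ j₁ m j₃ (insertBit C q₂ m)) <|
        blueMove okb 2 j₂ j₃ j₄ (fun m =>
          search q₀ q₄ j₀ j₄ fuel 2 1 q₁ q₂ q₃ j₁ j₂ m (insertBit C q₃ m)) acc := by
  cases h : isStuck q₀ q₄ j₀ j₄ q₁ q₂ q₃ j₁ j₂ j₃
  · rw [if_neg (by simp)]
    change (Bool.rec _ _ (isStuck q₀ q₄ j₀ j₄ q₁ q₂ q₃ j₁ j₂ j₃) : List ℕ) = _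
    rw [h]
    rfl
  · rw [if_pos rfl]
    change (Bool.rec _ _ (isStuck q₀ q₄ j₀ j₄ q₁ q₂ q₃ j₁ j₂ j₃) : List ℕ) = _
    rw [h]

/-- The branches are chained through the accumulator and only add to it, so what one branch finds
survives the branches applied after it. -/
theorem subset_search (q₀ q₄ j₀ j₄ fuel okr okb q₁ q₂ q₃ j₁ j₂ j₃ C : ℕ) (acc : List ℕ) :
    acc ⊆ search q₀ q₄ j₀ j₄ fuel okr okb q₁ q₂ q₃ j₁ j₂ j₃ C acc := by
  induction fuel generalizing okr okb q₁ q₂ q₃ j₁ j₂ j₃ C acc with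
  | zero => exact List.subset_cons_self _ _
  | succ fuel ih =>
    rw [search_succ]
    split_ifs
    · exact List.subset_cons_self _ _
    · refine List.Subset.trans ?_ (subset_redMove (fun m acc => ih _ _ _ _ _ _ _ _ _ _) _)
      refine List.Subset.trans ?_ (subset_redMove (fun m acc => ih _ _ _ _ _ _ _ _ _ _) _)
      refine List.Subset.trans ?_ (subset_redMove (fun m acc => ih _ _ _ _ _ _ _ _ _ _) _)
      refine List.Subset.trans ?_ (subset_blueMove (fun m acc => ih _ _ _ _ _ _ _ _ _ _) _)
      refine List.Subset.trans ?_ (subset_blueMove (fun m acc => ih _ _ _ _ _ _ _ _ _ _) _)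
      exact subset_blueMove (fun m acc => ih _ _ _ _ _ _ _ _ _ _) _

end ChamberSearch

/-! ### Codes of minors -/

open StringCrossing ChamberSearch

/-- The row part of the code of a minor: the set of the places `7 - i` for the rows `i` that do not
occur. -/
def rowCode {n : ℕ} (s : Finset (Fin n)) : ℕ := ∑ i ∈ sᶜ, 2 ^ (7 - i.val)

/-- The column part of the code of a minor: the set of the columns that occur, and of the columns
from `n` to `3`. -/
def colCode {n : ℕ} (s : Finset (Fin n)) : ℕ := ∑ i ∈ s, 2 ^ i.val + (16 - 2 ^ n)

/-- A set of four places out of eight that describes a minor of an `n × n` matrix, `n ≤ 4`, as a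
number. -/
def MinorIndex.code {n : ℕ} (D : MinorIndex n) : ℕ := rowCode D.rows + colCode D.cols

section Codes

variable {n : ℕ}

theorem below_zero (σ : Equiv.Perm (Fin n)) : below σ 0 = ∅ := by
  simp [below]

theorem below_of_le (σ : Equiv.Perm (Fin n)) {k : ℕ} (hk : n ≤ k) : below σ k = Finset.univ := by
  ext a
  simp only [below, Finset.mem_map, Finset.mem_filter, Finset.mem_univ, true_and, iff_true]
  exact ⟨σ⁻¹ a, (σ⁻¹ a).isLt.trans_le hk, Equiv.apply_symm_apply σ a⟩

theorem below_succ (σ : Equiv.Perm (Fin n)) (p : Fin n) :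
    below σ (p.val + 1) = insert (σ p) (below σ p.val) := by
  ext a
  simp only [below, Finset.mem_map, Finset.mem_filter, Finset.mem_univ, true_and,
    Finset.mem_insert, Equiv.coe_toEmbedding]
  constructor
  · rintro ⟨q, hq, rfl⟩
    rcases Nat.lt_succ_iff_lt_or_eq.mp hq with h | h
    · exact Or.inr ⟨q, h, rfl⟩
    · exact Or.inl (congrArg σ (Fin.ext h))
  · rintro (rfl | ⟨q, hq, rfl⟩)
    · exact ⟨p, Nat.lt_succ_self _, rfl⟩
    · exact ⟨q, hq.trans (Nat.lt_succ_self _), rfl⟩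

theorem apply_notMem_below (σ : Equiv.Perm (Fin n)) (p : Fin n) : σ p ∉ below σ p.val := by
  simp [below]

theorem rowCode_below (σ : Equiv.Perm (Fin n)) (p : Fin n) :
    rowCode (below σ p.val) = rowCode (below σ (p.val + 1)) + 2 ^ (7 - (σ p).val) := by
  have h := apply_notMem_below σ p
  rw [below_succ, rowCode, rowCode, Finset.compl_insert,
    Finset.sum_erase_add _ _ (Finset.mem_compl.mpr h)]

theorem colCode_below (σ : Equiv.Perm (Fin n)) (p : Fin n) :
    colCode (below σ (p.val + 1)) = colCode (below σ p.val) + 2 ^ (σ p).val := by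
  have h := apply_notMem_below σ p
  rw [below_succ, colCode, colCode, Finset.sum_insert h]
  omega

theorem rowCode_univ : rowCode (Finset.univ : Finset (Fin n)) = 0 := by
  simp [rowCode]

theorem colCode_univ (hn : n ≤ 4) : colCode (Finset.univ : Finset (Fin n)) = 15 := by
  interval_cases n <;> rfl

theorem colCode_le (hn : n ≤ 4) (s : Finset (Fin n)) : colCode s ≤ 15 := by
  rw [← colCode_univ hn]
  exact Nat.add_le_add_right (Finset.sum_le_sum_of_subset (Finset.subset_univ s)) _

theorem isLegal_red_iff {s : Orders n} {x : StringCrossing n} (hx : x.color = .red) :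
    IsLegal s x ↔ s .red x.upperPos < s .red x.lowerPos := by
  unfold IsLegal
  rw [hx]
  exact Fin.rev_lt_rev

theorem isLegal_blue_iff {s : Orders n} {x : StringCrossing n} (hx : x.color = .blue) :
    IsLegal s x ↔ s .blue x.lowerPos < s .blue x.upperPos := by
  unfold IsLegal
  rw [hx]
  rfl

end Codes

section Codes

variable {n : ℕ}

/-- From each height to the next one string is added, and codes are additive, so exchanging two
neighbours replaces the middle one of three successive codes `a`, `b`, `c` by `a + c - b`. Missing
rows count with weights that decrease in the row; hence the code drops exactly at a first meeting of
two red strings. -/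
theorem rowCode_window (hn : n ≤ 4) (σ : Equiv.Perm (Fin n)) (x : StringCrossing n) :
    rowCode (below σ x.level) + rowCode (below σ (x.level + 2)) - rowCode (below σ (x.level + 1)) =
        rowCode (below (σ * Equiv.swap x.lowerPos x.upperPos) (x.level + 1)) ∧
      (rowCode (below σ x.level) + rowCode (below σ (x.level + 2)) -
        rowCode (below σ (x.level + 1)) < rowCode (below σ (x.level + 1)) ↔
          σ x.upperPos < σ x.lowerPos) := by
  have h1 := rowCode_below σ x.lowerPos
  have h2 := rowCode_below σ x.upperPos
  have h3 := rowCode_below (σ * Equiv.swap x.lowerPos x.upperPos) x.upperPos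
  rw [Equiv.Perm.mul_apply, Equiv.swap_apply_right] at h3
  rw [lowerPos_val] at h1
  rw [upperPos_val] at h2 h3
  rw [show x.level.val + 1 + 1 = x.level.val + 2 from rfl] at h2 h3
  rw [below_mul_swap (k := x.level.val + 2) σ x (by omega)] at h3
  have h4 : (σ x.upperPos < σ x.lowerPos) ↔
      2 ^ (7 - (σ x.lowerPos).val) < 2 ^ (7 - (σ x.upperPos).val) := by
    rw [Nat.pow_lt_pow_iff_right (by norm_num), Fin.lt_def]
    omega
  rw [h4]
  omega

/-- As for rows, except that present columns count with increasing weights: the code rises exactly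
at a first meeting of two blue strings. -/
theorem colCode_window (σ : Equiv.Perm (Fin n)) (x : StringCrossing n) :
    colCode (below σ x.level) + colCode (below σ (x.level + 2)) - colCode (below σ (x.level + 1)) =
        colCode (below (σ * Equiv.swap x.lowerPos x.upperPos) (x.level + 1)) ∧
      (colCode (below σ (x.level + 1)) < colCode (below σ x.level) +
        colCode (below σ (x.level + 2)) - colCode (below σ (x.level + 1)) ↔
          σ x.lowerPos < σ x.upperPos) := by
  have h1 := colCode_below σ x.lowerPos
  have h2 := colCode_below σ x.upperPos
  have h3 := colCode_below (σ * Equiv.swap x.lowerPos x.upperPos) x.lowerPos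
  rw [Equiv.Perm.mul_apply, Equiv.swap_apply_left] at h3
  rw [lowerPos_val] at h1 h3
  rw [upperPos_val] at h2
  rw [show x.level.val + 1 + 1 = x.level.val + 2 from rfl] at h2
  rw [below_mul_swap (k := x.level.val) σ x (by omega)] at h3
  have h4 : (σ x.lowerPos < σ x.upperPos) ↔
      2 ^ (σ x.lowerPos).val < 2 ^ (σ x.upperPos).val := by
    rw [Nat.pow_lt_pow_iff_right (by norm_num), Fin.lt_def]
  rw [h4]
  omega

theorem isStuck_eq_true_iff {q₀ q₄ j₀ j₄ q₁ q₂ q₃ j₁ j₂ j₃ : ℕ} :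
    isStuck q₀ q₄ j₀ j₄ q₁ q₂ q₃ j₁ j₂ j₃ = true ↔
      (q₁ ≤ q₀ + q₂ - q₁ ∧ q₂ ≤ q₁ + q₃ - q₂ ∧ q₃ ≤ q₂ + q₄ - q₃) ∧
        (j₀ + j₂ - j₁ ≤ j₁ ∧ j₁ + j₃ - j₂ ≤ j₂ ∧ j₂ + j₄ - j₃ ≤ j₃) := by
  simp only [isStuck, Bool.and_eq_true, Nat.ble_eq, and_assoc]
  rfl

/-- The search, started from the orders `s`. -/
noncomputable abbrev searchFrom (s : Orders n) (fuel okr okb C : ℕ) (acc : List ℕ) : List ℕ :=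
  search (rowCode (below (s .red) 0)) (rowCode (below (s .red) 4))
    (colCode (below (s .blue) 0)) (colCode (below (s .blue) 4)) fuel okr okb
    (rowCode (below (s .red) 1)) (rowCode (below (s .red) 2)) (rowCode (below (s .red) 3))
    (colCode (below (s .blue) 1)) (colCode (below (s .blue) 2)) (colCode (below (s .blue) 3)) C acc

/-- From height `n` on the codes are constantly `0` for rows and `15` for columns, which rules out
moves there. This lets fewer than four strings be treated by the search for four. -/
theorem isStuck_of_isComplete_nil (hn : n ≤ 4) {s : Orders n} (h : IsComplete s []) :
    isStuck (rowCode (below (s .red) 0)) (rowCode (below (s .red) 4))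
      (colCode (below (s .blue) 0)) (colCode (below (s .blue) 4))
      (rowCode (below (s .red) 1)) (rowCode (below (s .red) 2)) (rowCode (below (s .red) 3))
      (colCode (below (s .blue) 1)) (colCode (below (s .blue) 2))
      (colCode (below (s .blue) 3)) = true := by
  have hr : ∀ l, rowCode (below (s .red) (l + 1)) ≤
      rowCode (below (s .red) l) + rowCode (below (s .red) (l + 2)) -
        rowCode (below (s .red) (l + 1)) := by
    intro l
    by_cases hl : l + 1 < n
    · have h1 := h ⟨.red, ⟨l, by omega⟩⟩
      rw [isLegal_red_iff rfl] at h1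
      exact not_lt.mp ((rowCode_window hn (s .red) ⟨.red, ⟨l, by omega⟩⟩).2.not.mpr h1)
    · rw [below_of_le _ (show n ≤ l + 1 by omega), rowCode_univ]
      exact Nat.zero_le _
  have hb : ∀ l, colCode (below (s .blue) l) + colCode (below (s .blue) (l + 2)) -
        colCode (below (s .blue) (l + 1)) ≤ colCode (below (s .blue) (l + 1)) := by
    intro l
    by_cases hl : l + 1 < n
    · have h1 := h ⟨.blue, ⟨l, by omega⟩⟩
      rw [isLegal_blue_iff rfl] at h1
      exact not_lt.mp ((colCode_window (s .blue) ⟨.blue, ⟨l, by omega⟩⟩).2.not.mpr h1)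
    · rw [below_of_le _ (show n ≤ l + 1 by omega), below_of_le _ (show n ≤ l + 2 by omega),
        colCode_univ hn]
      have := colCode_le hn (below (s .blue) l)
      omega
  exact isStuck_eq_true_iff.mpr ⟨⟨hr 0, hr 1, hr 2⟩, ⟨hb 0, hb 1, hb 2⟩⟩

theorem mem_redMove {ok l a b c : ℕ} {next : ℕ → List ℕ → List ℕ} {acc : List ℕ} {P : ℕ → Prop}
    (h : ok ≤ l ∧ a + c - b < b) (hP : ∃ k ∈ next (a + c - b) acc, P k) :
    ∃ k ∈ redMove ok l a b c next acc, P k := by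
  rwa [redMove_eq, if_pos h]

theorem mem_blueMove {ok l a b c : ℕ} {next : ℕ → List ℕ → List ℕ} {acc : List ℕ} {P : ℕ → Prop}
    (h : ok ≤ l ∧ b < a + c - b) (hP : ∃ k ∈ next (a + c - b) acc, P k) :
    ∃ k ∈ blueMove ok l a b c next acc, P k := by
  rwa [blueMove_eq, if_pos h]

theorem exists_mem_of_subset {l l' : List ℕ} {P : ℕ → Prop} (hs : l ⊆ l') (h : ∃ k ∈ l, P k) :
    ∃ k ∈ l', P k :=
  h.imp fun _ hk => ⟨hs hk.1, hk.2⟩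

/-- The search is followed along the given word. The set found need not be identified with the
chambers of the word; it only matters that its elements inherit the property `A` of their codes,
which will be that of being a unit. -/
theorem exists_mem_searchFrom (hn : n ≤ 4) (A : ℕ → Prop) (fuel : ℕ) (s : Orders n)
    (w : List (StringCrossing n)) (okr okb C : ℕ) (acc : List ℕ) (hw : IsComplete s w)
    (hc : w.IsChain InOrder)
    (hok : ∀ x v, w = x :: v → (x.color = .red → okr ≤ x.level.val) ∧
      (x.color = .blue → okb ≤ x.level.val))
    (hA : ∀ D ∈ chambers s w, A D.code) (hC : ∀ i, C.testBit i → A i) :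
    ∃ c ∈ searchFrom s fuel okr okb C acc, ∀ i, c.testBit i → A i := by
  induction fuel generalizing s w okr okb C acc with
  | zero => exact ⟨0, List.mem_cons_self, by simp⟩
  | succ fuel ih =>
    unfold searchFrom
    rw [search_succ]
    cases w with
    | nil =>
      rw [if_pos (isStuck_of_isComplete_nil hn hw)]
      exact ⟨C, List.mem_cons_self, hC⟩
    | cons x v =>
      have hl : x.level.val < 3 := by omega
      have hl' : x.level.val < n := by omega
      have hmem : A (rowCode (below (cross s x .red) (x.level.val + 1)) +
          colCode (below (cross s x .blue) (x.level.val + 1))) :=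
        hA _ (Or.inr (chamberAt_mem_chambers (cross s x) v hl'))
      have next : ∀ (okr okb C' : ℕ) (acc : List ℕ),
          (x.color = .red → okr = x.level.val - 1 ∧ okb = x.level.val) →
          (x.color = .blue → okr = x.level.val ∧ okb = x.level.val - 1) →
          C' = insertBit C (rowCode (below (cross s x .red) (x.level.val + 1)))
            (colCode (below (cross s x .blue) (x.level.val + 1))) →
          ∃ c ∈ searchFrom (cross s x) fuel okr okb C' acc, ∀ i, c.testBit i → A i := by
        rintro okr okb C' acc hr hb rfl
        refine ih (cross s x) v _ _ _ _ hw.2 hc.tail ?_ (fun D hD => hA D (Or.inr hD)) ?_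
        · rintro y v' rfl
          have hxy : InOrder x y := by
            rw [List.isChain_cons_cons] at hc
            exact hc.1
          unfold InOrder at hxy
          cases hxc : x.color <;> cases hyc : y.color <;> simp_all <;> omega
        · intro i hi
          rcases testBit_insertBit hi with h | rfl
          · exact hC i h
          · exact hmem
      have hb : ∀ (c : StringColor) (k : ℕ), k ≠ x.level.val + 1 →
          below (cross s x c) k = below (s c) k := fun c k hk => below_cross s x c hk
      have hlegal := hw.1
      have hokx := hok x v rfl
      cases hx : x.color with
      | red =>
        have hcr : cross s x .red = s .red * Equiv.swap x.lowerPos x.upperPos := by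
          simp [cross, hx]
        rw [isLegal_red_iff hx] at hlegal
        obtain ⟨e1, e2⟩ := rowCode_window hn (s .red) x
        have e2 := e2.mpr hlegal
        have hok1 := hokx.1 hx
        have next := fun acc => next _ _ _ acc (fun _ => ⟨rfl, rfl⟩) (by simp [hx]) rfl
        rw [← hcr] at e1
        unfold searchFrom at next
        have h3 : x.level.val = 0 ∨ x.level.val = 1 ∨ x.level.val = 2 := by omega
        have hoth : cross s x .blue = s .blue := by simp [cross, hx]
        rcases h3 with h3 | h3 | h3
        · rw [h3] at e1 e2 hok1 next
          norm_num only at e1 e2 next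
          rw [if_neg (by rw [isStuck_eq_true_iff]; omega)]
          refine mem_redMove ⟨hok1, e2⟩ ?_
          rw [e1]
          simpa only [hb .red 0 (by omega), hb .red 2 (by omega), hb .red 3 (by omega), hb .red 4 (by omega), hb .blue 0 (by omega), hb .blue 2 (by omega), hb .blue 3 (by omega), hb .blue 4 (by omega), hoth] using next _
        · rw [h3] at e1 e2 hok1 next
          norm_num only at e1 e2 next
          rw [if_neg (by rw [isStuck_eq_true_iff]; omega)]
          refine exists_mem_of_subset (subset_redMove (fun _ _ => subset_search ..) _) ?_
          refine mem_redMove ⟨hok1, e2⟩ ?_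
          rw [e1]
          simpa only [hb .red 0 (by omega), hb .red 1 (by omega), hb .red 3 (by omega), hb .red 4 (by omega), hb .blue 0 (by omega), hb .blue 1 (by omega), hb .blue 3 (by omega), hb .blue 4 (by omega), hoth] using next _
        · rw [h3] at e1 e2 hok1 next
          norm_num only at e1 e2 next
          rw [if_neg (by rw [isStuck_eq_true_iff]; omega)]
          refine exists_mem_of_subset (subset_redMove (fun _ _ => subset_search ..) _) ?_
          refine exists_mem_of_subset (subset_redMove (fun _ _ => subset_search ..) _) ?_
          refine mem_redMove ⟨hok1, e2⟩ ?_
          rw [e1]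
          simpa only [hb .red 0 (by omega), hb .red 1 (by omega), hb .red 2 (by omega), hb .red 4 (by omega), hb .blue 0 (by omega), hb .blue 1 (by omega), hb .blue 2 (by omega), hb .blue 4 (by omega), hoth] using next _
      | blue =>
        have hcr : cross s x .blue = s .blue * Equiv.swap x.lowerPos x.upperPos := by
          simp [cross, hx]
        rw [isLegal_blue_iff hx] at hlegal
        obtain ⟨e1, e2⟩ := colCode_window (s .blue) x
        have e2 := e2.mpr hlegal
        have hok1 := hokx.2 hx
        have next := fun acc => next _ _ _ acc (by simp [hx]) (fun _ => ⟨rfl, rfl⟩) rfl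
        rw [← hcr] at e1
        unfold searchFrom at next
        have h3 : x.level.val = 0 ∨ x.level.val = 1 ∨ x.level.val = 2 := by omega
        have hoth : cross s x .red = s .red := by simp [cross, hx]
        rcases h3 with h3 | h3 | h3
        · rw [h3] at e1 e2 hok1 next
          norm_num only at e1 e2 next
          rw [if_neg (by rw [isStuck_eq_true_iff]; omega)]
          refine exists_mem_of_subset (subset_redMove (fun _ _ => subset_search ..) _) ?_
          refine exists_mem_of_subset (subset_redMove (fun _ _ => subset_search ..) _) ?_
          refine exists_mem_of_subset (subset_redMove (fun _ _ => subset_search ..) _) ?_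
          refine mem_blueMove ⟨hok1, e2⟩ ?_
          rw [e1]
          simpa only [hb .red 0 (by omega), hb .red 2 (by omega), hb .red 3 (by omega), hb .red 4 (by omega), hb .blue 0 (by omega), hb .blue 2 (by omega), hb .blue 3 (by omega), hb .blue 4 (by omega), hoth] using next _
        · rw [h3] at e1 e2 hok1 next
          norm_num only at e1 e2 next
          rw [if_neg (by rw [isStuck_eq_true_iff]; omega)]
          refine exists_mem_of_subset (subset_redMove (fun _ _ => subset_search ..) _) ?_
          refine exists_mem_of_subset (subset_redMove (fun _ _ => subset_search ..) _) ?_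
          refine exists_mem_of_subset (subset_redMove (fun _ _ => subset_search ..) _) ?_
          refine exists_mem_of_subset (subset_blueMove (fun _ _ => subset_search ..) _) ?_
          refine mem_blueMove ⟨hok1, e2⟩ ?_
          rw [e1]
          simpa only [hb .red 0 (by omega), hb .red 1 (by omega), hb .red 3 (by omega), hb .red 4 (by omega), hb .blue 0 (by omega), hb .blue 1 (by omega), hb .blue 3 (by omega), hb .blue 4 (by omega), hoth] using next _
        · rw [h3] at e1 e2 hok1 next
          norm_num only at e1 e2 next
          rw [if_neg (by rw [isStuck_eq_true_iff]; omega)]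
          refine exists_mem_of_subset (subset_redMove (fun _ _ => subset_search ..) _) ?_
          refine exists_mem_of_subset (subset_redMove (fun _ _ => subset_search ..) _) ?_
          refine exists_mem_of_subset (subset_redMove (fun _ _ => subset_search ..) _) ?_
          refine exists_mem_of_subset (subset_blueMove (fun _ _ => subset_search ..) _) ?_
          refine exists_mem_of_subset (subset_blueMove (fun _ _ => subset_search ..) _) ?_
          refine mem_blueMove ⟨hok1, e2⟩ ?_
          rw [e1]
          simpa only [hb .red 0 (by omega), hb .red 1 (by omega), hb .red 2 (by omega), hb .red 4 (by omega), hb .blue 0 (by omega), hb .blue 1 (by omega), hb .blue 2 (by omega), hb .blue 4 (by omega), hoth] using next _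

end Codes

/-! ### Closure of many sets under rules at once, with one lane of bits per set -/

namespace ChamberSearch

/-- A rule for sets of places, to be applied after all shifts by an element of `mask`: if the place
`divisor` is in a set of divisors and the places in `need` are in the given set, then `target` is
added to it. -/
structure LaneRule where
  divisor : ℕ
  target : ℕ
  need : List ℕ
  mask : ℕ

/-- The rule `r` leads from `A` (divisors) and `G` to `G` only, when the places are below `W`. -/
def LaneRule.IsSound (W : ℕ) (A G : ℕ → Prop) (r : LaneRule) : Prop :=
  r.mask < 2 ^ W ∧ ∀ s, r.mask.testBit s → s + r.divisor < W ∧ s + r.target < W ∧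
    (∀ i ∈ r.need, s + i < W) ∧ (A (s + r.divisor) → (∀ i ∈ r.need, G (s + i)) → G (s + r.target))

/-- The shifts in `m` after which all places in `need` are in `S`. -/
def selectShifts (S m : ℕ) (need : List ℕ) : ℕ :=
  List.rec m (fun i _ ih => Nat.land (Nat.shiftRight S i) ih) need

/-- Apply a rule in all lanes of `S` at once. -/
def applyRule (ones C : ℕ) (r : LaneRule) (S : ℕ) : ℕ :=
  Nat.lor S (Nat.shiftLeft (selectShifts S
    (Nat.land (Nat.shiftRight C r.divisor) (Nat.mul r.mask ones)) r.need) r.target)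

/-- Apply the rules in a list one after the other. -/
noncomputable def applyRules (ones C : ℕ) (t : List LaneRule) : ℕ → ℕ :=
  List.rec (motive := fun _ => ℕ → ℕ) (fun S => S)
    (fun r _ ih S => force (applyRule ones C r S) ih) t

/-- Apply the rules in a list repeatedly, with a mark in the lowest lane before every round. -/
noncomputable def iterateRules (W ones C : ℕ) (t : List LaneRule) (k : ℕ) : ℕ → ℕ :=
  Nat.rec (motive := fun _ => ℕ → ℕ) (fun S => S)
    (fun m ih S => force (Nat.lor S (Nat.mod (Nat.pow 2 m) (Nat.pow 2 W))) fun S =>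
      force (applyRules ones C t S) ih) k

/-- Put the sets of places in a list into lanes of width `W`. -/
def pack (W : ℕ) (l : List ℕ) : ℕ :=
  List.rec 0 (fun c _ ih => Nat.add (Nat.mul (Nat.pow 2 W) ih) (Nat.mod c (Nat.pow 2 W))) l

/-- The elements of the list for whose lane `S` does not contain `full`. The lanes start at the
place `o`. -/
noncomputable def remaining (W full S : ℕ) (l : List ℕ) : ℕ → List ℕ :=
  List.rec (motive := fun _ => ℕ → List ℕ) (fun _ => [])
    (fun c _ ih o => Bool.rec (c :: force (Nat.add o W) ih) (force (Nat.add o W) ih)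
      (Nat.beq (Nat.land (Nat.shiftRight S o) full) full)) l

/-- The chamber sets in a list from which the rules do not lead to all of `full`. The lowest lane
is not used for a set; it holds a number that makes it easy to tell the occurring numbers apart. -/
noncomputable def unresolved (W full : ℕ) (t : List LaneRule) (k : ℕ) (l : List ℕ) : List ℕ :=
  force (pack W (0 :: l.map fun _ => 1)) fun ones => force (pack W l) fun C =>
    force (Nat.add (Nat.mul (Nat.pow 2 W) C)
      (Nat.mod (Nat.mul (Nat.mod C 72057594037927931) 256) (Nat.pow 2 W))) fun C =>
        force (iterateRules W ones C t k C) fun S => remaining W full S l W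

/-- Apply `f` to segments of length `k` of a list. -/
noncomputable def bySegments (k : ℕ) (f : List ℕ → List ℕ) (fuel : ℕ) : List ℕ → List ℕ :=
  Nat.rec (motive := fun _ => List ℕ → List ℕ) f
    (fun _ ih l => List.rec [] (fun _ _ _ => f (l.take k) ++ ih (l.drop k)) l) fuel

/-- The places in the lane `k` of `S` satisfy `G`. -/
def LaneSatisfies (W k S : ℕ) (G : ℕ → Prop) : Prop :=
  ∀ i < W, S.testBit (W * k + i) → G i

/-- Evaluate `f` at `l`, after the evaluation of the elements of `l`. -/
noncomputable def forceList {α : Type} (l : List ℕ) : (List ℕ → α) → α :=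
  List.rec (motive := fun _ => (List ℕ → α) → α) (fun f => f [])
    (fun a _ ih f => force a fun a => ih fun l => f (a :: l)) l

/-- Evaluate `f` at `t`, after the evaluation of the rules in `t`. -/
noncomputable def forceRules {α : Type} (t : List LaneRule) : (List LaneRule → α) → α :=
  List.rec (motive := fun _ => (List LaneRule → α) → α) (fun f => f [])
    (fun r _ ih f => force r.divisor fun a => force r.target fun b => forceList r.need fun l =>
      force r.mask fun m => ih fun t => f (⟨a, b, l, m⟩ :: t)) t

theorem forceList_eq {α : Type} (l : List ℕ) (f : List ℕ → α) : forceList l f = f l := by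
  induction l generalizing f with
  | nil => rfl
  | cons a l ih =>
    change (force a fun a => forceList l fun l => f (a :: l)) = _
    rw [force_eq, ih]

theorem forceRules_eq {α : Type} (t : List LaneRule) (f : List LaneRule → α) :
    forceRules t f = f t := by
  induction t generalizing f with
  | nil => rfl
  | cons r t ih =>
    change (force r.divisor fun a => force r.target fun b => forceList r.need fun l =>
      force r.mask fun m => forceRules t fun t => f (⟨a, b, l, m⟩ :: t)) = _
    rw [force_eq, force_eq, forceList_eq, force_eq, ih]

theorem selectShifts_testBit {S m p : ℕ} {need : List ℕ}
    (h : (selectShifts S m need).testBit p) :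
    m.testBit p ∧ ∀ i ∈ need, S.testBit (i + p) := by
  induction need with
  | nil => exact ⟨h, by simp⟩
  | cons a l ih =>
    change ((S >>> a) &&& selectShifts S m l).testBit p = true at h
    rw [Nat.testBit_and, Bool.and_eq_true, Nat.testBit_shiftRight] at h
    have := ih h.2
    refine ⟨this.1, fun i hi => ?_⟩
    rcases List.mem_cons.mp hi with rfl | hi
    · exact h.1
    · exact this.2 i hi

/-- A selected bit `p` encodes a lane `p / W` and a shift `p % W`, and the shift lies in the mask by
`hones`. A sound rule stays below `W` after every shift in its mask, so no lane reads from or writes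
to another one. -/
theorem applyRule_satisfies {W k ones C S : ℕ} {A G : ℕ → Prop} {r : LaneRule}
    (hr : r.IsSound W A G)
    (hones : ∀ m < 2 ^ W, ∀ p, (m * ones).testBit p → m.testBit (p % W))
    (hC : LaneSatisfies W k C A) (hS : LaneSatisfies W k S G) :
    LaneSatisfies W k (applyRule ones C r S) G := by
  intro i hi h
  change (S ||| (selectShifts S ((C >>> r.divisor) &&& (r.mask * ones)) r.need) <<< r.target).testBit
    _ = true at h
  rw [Nat.testBit_or, Bool.or_eq_true, Nat.testBit_shiftLeft, Bool.and_eq_true,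
    decide_eq_true_iff] at h
  rcases h with h | ⟨h1, h2⟩
  · exact hS i hi h
  · obtain ⟨h3, h4⟩ := selectShifts_testBit h2
    rw [Nat.testBit_and, Bool.and_eq_true, Nat.testBit_shiftRight] at h3
    obtain ⟨h3, h5⟩ := h3
    set p := W * k + i - r.target with hp
    obtain ⟨b1, b2, b3, b4⟩ := hr.2 _ (hones _ hr.1 p h5)
    have hW : 0 < W := by omega
    have e1 : p = W * (p / W) + p % W := (Nat.div_add_mod p W).symm
    have e2 : W * (p / W) + (p % W + r.target) = W * k + i := by omega
    have e3 : p / W = k := by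
      have h1 := congrArg (· / W) e2
      simpa [Nat.mul_add_div hW, Nat.div_eq_of_lt b2, Nat.div_eq_of_lt hi] using h1
    have e4 : p % W + r.target = i := by
      rw [e3] at e2
      omega
    rw [e3] at e1
    rw [← e4]
    have e5 : W * k + (p % W + r.divisor) = r.divisor + p := by omega
    have e6 : ∀ j, W * k + (p % W + j) = j + p := fun j => by omega
    refine b4 (hC _ b1 ?_) fun j hj => hS _ (b3 j hj) ?_
    · rw [e5]
      exact h3
    · rw [e6]
      exact h4 j hj

theorem applyRules_satisfies {W k ones C S : ℕ} {A G : ℕ → Prop} {t : List LaneRule}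
    (hr : ∀ r ∈ t, r.IsSound W A G)
    (hones : ∀ m < 2 ^ W, ∀ p, (m * ones).testBit p → m.testBit (p % W))
    (hC : LaneSatisfies W k C A) (hS : LaneSatisfies W k S G) :
    LaneSatisfies W k (applyRules ones C t S) G := by
  induction t generalizing S with
  | nil => exact hS
  | cons r t ih =>
    change LaneSatisfies W k (force (applyRule ones C r S) (applyRules ones C t)) G
    rw [force_eq]
    exact ih (fun r' hr' => hr r' (List.mem_cons_of_mem _ hr'))
      (applyRule_satisfies (hr r List.mem_cons_self) hones hC hS)

/-- The mark of each round is reduced below `2 ^ W`, so it stays in lane `0` and does not affect the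
lanes with `k ≠ 0`. -/
theorem iterateRules_satisfies {W k ones C S : ℕ} {A G : ℕ → Prop} {t : List LaneRule} (m : ℕ)
    (hk : k ≠ 0) (hr : ∀ r ∈ t, r.IsSound W A G)
    (hones : ∀ m < 2 ^ W, ∀ p, (m * ones).testBit p → m.testBit (p % W))
    (hC : LaneSatisfies W k C A) (hS : LaneSatisfies W k S G) :
    LaneSatisfies W k (iterateRules W ones C t m S) G := by
  induction m generalizing S with
  | zero => exact hS
  | succ m ih =>
    change LaneSatisfies W k (force (S ||| 2 ^ m % 2 ^ W) fun S =>
      force (applyRules ones C t S) (iterateRules W ones C t m)) G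
    rw [force_eq, force_eq]
    refine ih (applyRules_satisfies hr hones hC fun i hi h => hS i hi ?_)
    rw [Nat.testBit_or, Bool.or_eq_true] at h
    refine h.resolve_right fun h => ?_
    rw [Nat.testBit_mod_two_pow, Bool.and_eq_true, decide_eq_true_iff] at h
    exact absurd h.1 (not_lt.mpr (le_add_right (Nat.le_mul_of_pos_right W (Nat.pos_of_ne_zero hk))))

theorem pack_cons (W c : ℕ) (l : List ℕ) : pack W (c :: l) = 2 ^ W * pack W l + c % 2 ^ W := rfl

/-- Since `m` fits into a lane, multiplying it by a number with a one at the start of each lane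
copies it into the lanes without carries. -/
theorem testBit_mul_pack_map_one {W m : ℕ} (hm : m < 2 ^ W) (l : List ℕ) (p : ℕ)
    (h : (m * pack W (l.map fun _ => 1)).testBit p) : m.testBit (p % W) := by
  rcases Nat.eq_zero_or_pos W with rfl | hW
  · obtain rfl : m = 0 := by simpa using hm
    simp at h
  induction l generalizing p with
  | nil => simp [pack] at h
  | cons c l ih =>
    rw [List.map_cons, pack_cons, Nat.mod_eq_of_lt (Nat.one_lt_two_pow hW.ne'), mul_add, mul_one,
      mul_left_comm, Nat.testBit_two_pow_mul_add _ hm] at h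
    split_ifs at h with hp
    · rwa [Nat.mod_eq_of_lt hp]
    · rw [Nat.mod_eq_sub_mod (not_lt.mp hp)]
      exact ih _ h

theorem testBit_mul_pack_ones {W m : ℕ} (hm : m < 2 ^ W) (l : List ℕ) (p : ℕ)
    (h : (m * pack W (0 :: l.map fun _ => 1)).testBit p) : m.testBit (p % W) := by
  rw [pack_cons, Nat.zero_mod, add_zero, mul_left_comm, Nat.testBit_two_pow_mul,
    Bool.and_eq_true, decide_eq_true_iff] at h
  rw [Nat.mod_eq_sub_mod h.1]
  exact testBit_mul_pack_map_one hm l _ h.2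

theorem pack_satisfies {W k c : ℕ} {A : ℕ → Prop} {l : List ℕ} (hk : l[k]? = some c)
    (hc : ∀ i, c.testBit i → A i) : LaneSatisfies W k (pack W l) A := by
  induction l generalizing k with
  | nil => simp at hk
  | cons d l ih =>
    intro i hi h
    rw [pack_cons, Nat.testBit_two_pow_mul_add _ (Nat.mod_lt _ (Nat.two_pow_pos W))] at h
    cases k with
    | zero =>
      obtain rfl : d = c := by simpa using hk
      rw [if_pos (by omega), Nat.testBit_mod_two_pow] at h
      simp only [mul_zero, zero_add, Bool.and_eq_true] at h
      exact hc i h.2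
    | succ k =>
      rw [mul_add, mul_one, if_neg (by omega),
        show W * k + W + i - W = W * k + i by omega] at h
      exact ih (by simpa using hk) i hi h

theorem mem_remaining {W full k o c S : ℕ} {l : List ℕ} (hk : l[k]? = some c) :
    c ∈ remaining W full S l o ∨ ∀ i, full.testBit i → S.testBit (W * k + o + i) := by
  induction l generalizing k o with
  | nil => simp at hk
  | cons d l ih =>
    have e : remaining W full S (d :: l) o =
        Bool.rec (d :: remaining W full S l (o + W)) (remaining W full S l (o + W))
          (Nat.beq ((S >>> o) &&& full) full) := by
      change (Bool.rec (d :: force (o + W) (remaining W full S l))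
        (force (o + W) (remaining W full S l)) (Nat.beq ((S >>> o) &&& full) full) : List ℕ) = _
      rw [force_eq]
    rw [e]
    cases k with
    | zero =>
      obtain rfl : d = c := by simpa using hk
      cases hb : Nat.beq ((S >>> o) &&& full) full
      · exact Or.inl List.mem_cons_self
      · refine Or.inr fun i hi => ?_
        have h := congrArg (fun x => x.testBit i) (Nat.eq_of_beq_eq_true hb)
        simp only [Nat.testBit_and, hi, Bool.and_true, Nat.testBit_shiftRight] at h
        simpa using h
    | succ k =>
      rcases ih (k := k) (o := o + W) (by simpa using hk) with h | h
      · left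
        cases Nat.beq ((S >>> o) &&& full) full
        · exact List.mem_cons_of_mem _ h
        · exact h
      · right
        intro i hi
        rw [mul_add, mul_one, show W * k + W + o + i = W * k + (o + W) + i by ring]
        exact h i hi

/-- Soundness of one pass: a set either is handed on or has all of `full` derived from it. -/
theorem mem_unresolved {W full m c : ℕ} {t : List LaneRule} {l : List ℕ} {A G : ℕ → Prop}
    (hAG : ∀ i, A i → G i) (hr : ∀ r ∈ t, r.IsSound W A G) (hfull : full < 2 ^ W)
    (hc : c ∈ l) (hA : ∀ i, c.testBit i → A i) :
    c ∈ unresolved W full t m l ∨ ∀ i, full.testBit i → G i := by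
  obtain ⟨k, hk⟩ := List.mem_iff_getElem?.mp hc
  unfold unresolved
  rw [force_eq, force_eq, force_eq, force_eq]
  -- The number in the lowest lane is an additional head of the packed list, which moves entry `k`
  -- to lane `k + 1`.
  have hC : LaneSatisfies W (k + 1)
      (pack W (Nat.mul (Nat.mod (pack W l) 72057594037927931) 256 :: l)) A :=
    pack_satisfies (by simpa using hk) hA
  refine (mem_remaining hk).imp id fun h i hi => ?_
  refine iterateRules_satisfies m (Nat.succ_ne_zero k) hr
    (fun m hm p => testBit_mul_pack_ones hm l p) hC (fun i hi h => hAG i (hC i hi h)) i ?_ (h i hi)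
  by_contra hiW
  rw [Nat.testBit_lt_two_pow (hfull.trans_le (Nat.pow_le_pow_right two_pos (not_lt.mp hiW)))] at hi
  exact Bool.false_ne_true hi

/-- When the fuel is used up, `f` receives the whole rest, so the number and the length of the
segments do not matter for soundness. -/
theorem mem_bySegments {k c : ℕ} {f : List ℕ → List ℕ} {Q : Prop}
    (hf : ∀ l, c ∈ l → c ∈ f l ∨ Q) (fuel : ℕ) (l : List ℕ) (hc : c ∈ l) :
    c ∈ bySegments k f fuel l ∨ Q := by
  induction fuel generalizing l with
  | zero => exact hf l hc
  | succ fuel ih =>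
    cases l with
    | nil => simp at hc
    | cons d l =>
      change c ∈ f ((d :: l).take k) ++ bySegments k f fuel ((d :: l).drop k) ∨ Q
      rw [← List.take_append_drop k (d :: l), List.mem_append] at hc
      rw [List.mem_append]
      rcases hc with hc | hc
      · exact (hf _ hc).imp Or.inl id
      · exact (ih _ hc).imp Or.inr id

end ChamberSearch

/-! ### Plücker coordinates of four-dimensional vectors -/

section Plucker

variable {R : Type*} [CommRing R]

/-- The determinant of four vectors. -/
def bracket (x y z t : Fin 4 → R) : R :=
  (x 0 * y 1 - x 1 * y 0) * (z 2 * t 3 - z 3 * t 2) -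
    (x 0 * y 2 - x 2 * y 0) * (z 1 * t 3 - z 3 * t 1) +
    (x 0 * y 3 - x 3 * y 0) * (z 1 * t 2 - z 2 * t 1) +
    (x 1 * y 2 - x 2 * y 1) * (z 0 * t 3 - z 3 * t 0) -
    (x 1 * y 3 - x 3 * y 1) * (z 0 * t 2 - z 2 * t 0) +
    (x 2 * y 3 - x 3 * y 2) * (z 0 * t 1 - z 1 * t 0)

theorem bracket_swap₁ (x y z t : Fin 4 → R) : bracket y x z t = -bracket x y z t := by
  unfold bracket; ring

theorem bracket_swap₂ (x y z t : Fin 4 → R) : bracket x z y t = -bracket x y z t := by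
  unfold bracket; ring

theorem bracket_swap₃ (x y z t : Fin 4 → R) : bracket x y t z = -bracket x y z t := by
  unfold bracket; ring

theorem bracket_self₁ (x z t : Fin 4 → R) : bracket x x z t = 0 := by
  unfold bracket; ring

theorem bracket_self₂ (x y t : Fin 4 → R) : bracket x y y t = 0 := by
  unfold bracket; ring

theorem bracket_self₃ (x y z : Fin 4 → R) : bracket x y z z = 0 := by
  unfold bracket; ring

theorem bracket_self₄ (x y z : Fin 4 → R) : bracket x y z x = 0 := by
  unfold bracket; ring

theorem bracket_self₅ (x y z : Fin 4 → R) : bracket x y z y = 0 := by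
  unfold bracket; ring

/-- Cramer's rule for the expansion of `t` in terms of `a`, `b`, `c`, `d`. -/
theorem bracket_smul (a b c d : Fin 4 → R) (i : Fin 4) (t : Fin 4 → R) :
    bracket a b c d * t i = bracket t b c d * a i + bracket a t c d * b i + bracket a b t d * c i +
      bracket a b c t * d i := by
  fin_cases i <;> simp only [bracket, Fin.zero_eta, Fin.mk_one, Fin.reduceFinMk] <;> ring

theorem bracket_linear (x y z : Fin 4 → R) : ∃ l : Fin 4 → R, ∀ t,
    bracket x y z t = l 0 * t 0 + l 1 * t 1 + l 2 * t 2 + l 3 * t 3 := by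
  refine ⟨![
    (x 1 * y 2 - x 2 * y 1) * (- z 3) + (x 1 * y 3 - x 3 * y 1) * z 2 + (x 2 * y 3 - x 3 * y 2) * (- z 1),
    (x 0 * y 2 - x 2 * y 0) * z 3 + (x 0 * y 3 - x 3 * y 0) * (- z 2) + (x 2 * y 3 - x 3 * y 2) * z 0,
    (x 0 * y 1 - x 1 * y 0) * (- z 3) + (x 0 * y 3 - x 3 * y 0) * z 1 + (x 1 * y 3 - x 3 * y 1) * (- z 0),
    (x 0 * y 1 - x 1 * y 0) * z 2 + (x 0 * y 2 - x 2 * y 0) * (- z 1) + (x 1 * y 2 - x 2 * y 1) * z 0],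
    fun t => ?_⟩
  simp [bracket]
  ring

/-- The exchange relation. -/
theorem bracket_exchange (x y z t a b c d : Fin 4 → R) :
    bracket x y z t * bracket a b c d = bracket x y z a * bracket t b c d +
      bracket x y z b * bracket a t c d + bracket x y z c * bracket a b t d +
      bracket x y z d * bracket a b c t := by
  -- The relation is Cramer's rule after the linear form `bracket x y z` has been applied to it.
  obtain ⟨l, hl⟩ := bracket_linear x y z
  rw [hl t, hl a, hl b, hl c, hl d]
  linear_combination l 0 * bracket_smul a b c d 0 t + l 1 * bracket_smul a b c d 1 t +
    l 2 * bracket_smul a b c d 2 t + l 3 * bracket_smul a b c d 3 t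

/-- The sign of the order of two places. -/
def orderSign (i j : Fin 8) : ℤ := if i < j then 1 else if j < i then -1 else 0

/-- The sign of the order of four places. -/
def orderSign₄ (i j k l : Fin 8) : ℤ :=
  orderSign i j * orderSign i k * orderSign i l * orderSign j k * orderSign j l * orderSign k l

/-- The set of four places as a number. -/
def placeSet (i j k l : Fin 8) : ℕ := 2 ^ i.val + 2 ^ j.val + 2 ^ k.val + 2 ^ l.val

/-- The values of `p` at sets of four places are the maximal minors of eight vectors. -/
def IsPlucker (p : ℕ → R) : Prop :=
  ∃ v : Fin 8 → Fin 4 → R, ∀ i j k l : Fin 8, i < j → j < k → k < l →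
    p (placeSet i j k l) = bracket (v i) (v j) (v k) (v l)

/-- The alternating function of places that belongs to `p`. -/
def placeBracket (p : ℕ → R) (i j k l : Fin 8) : R :=
  (orderSign₄ i j k l : R) * p (placeSet i j k l)

theorem orderSign_swap (i j : Fin 8) : orderSign j i = -orderSign i j := by
  revert i j; decide

theorem placeBracket_swap₁ (p : ℕ → R) (i j k l : Fin 8) :
    placeBracket p j i k l = -placeBracket p i j k l := by
  rw [placeBracket, placeBracket, placeSet, placeSet, add_comm (2 ^ j.val), orderSign₄, orderSign₄,
    orderSign_swap i j]
  push_cast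
  ring

theorem placeBracket_swap₂ (p : ℕ → R) (i j k l : Fin 8) :
    placeBracket p i k j l = -placeBracket p i j k l := by
  rw [placeBracket, placeBracket, placeSet, placeSet, add_right_comm (2 ^ i.val), orderSign₄,
    orderSign₄, orderSign_swap j k]
  push_cast
  ring

theorem placeBracket_swap₃ (p : ℕ → R) (i j k l : Fin 8) :
    placeBracket p i j l k = -placeBracket p i j k l := by
  rw [placeBracket, placeBracket, placeSet, placeSet, add_right_comm (2 ^ i.val + 2 ^ j.val),
    orderSign₄, orderSign₄, orderSign_swap k l]
  push_cast
  ring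

theorem orderSign_self (i : Fin 8) : orderSign i i = 0 := by
  simp [orderSign]

theorem orderSign_of_lt {i j : Fin 8} (h : i < j) : orderSign i j = 1 := by
  simp [orderSign, h]

/-- Both sides are alternating, so sorting the places reduces the claim to increasing places;
repeated places give zero on both sides. -/
theorem IsPlucker.exists_placeBracket_eq {p : ℕ → R} (hp : IsPlucker p) :
    ∃ v : Fin 8 → Fin 4 → R, ∀ i j k l : Fin 8,
      placeBracket p i j k l = bracket (v i) (v j) (v k) (v l) := by
  obtain ⟨v, hv⟩ := hp
  refine ⟨v, ?_⟩
  have h₃ : ∀ i j k l : Fin 8, i < j → j < k → k < l →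
      placeBracket p i j k l = bracket (v i) (v j) (v k) (v l) := by
    intro i j k l hij hjk hkl
    rw [← hv i j k l hij hjk hkl, placeBracket, orderSign₄]
    simp [orderSign_of_lt, hij, hjk, hkl, hij.trans hjk, hjk.trans hkl, (hij.trans hjk).trans hkl]
  have s₁ : ∀ i j k l : Fin 8, placeBracket p j i k l = bracket (v j) (v i) (v k) (v l) →
      placeBracket p i j k l = bracket (v i) (v j) (v k) (v l) := by
    intro i j k l h
    rw [placeBracket_swap₁, bracket_swap₁, h]
  have s₂ : ∀ i j k l : Fin 8, placeBracket p i k j l = bracket (v i) (v k) (v j) (v l) →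
      placeBracket p i j k l = bracket (v i) (v j) (v k) (v l) := by
    intro i j k l h
    rw [placeBracket_swap₂, bracket_swap₂, h]
  have s₃ : ∀ i j k l : Fin 8, placeBracket p i j l k = bracket (v i) (v j) (v l) (v k) →
      placeBracket p i j k l = bracket (v i) (v j) (v k) (v l) := by
    intro i j k l h
    rw [placeBracket_swap₃, bracket_swap₃, h]
  have e₁ : ∀ i k l : Fin 8, placeBracket p i i k l = bracket (v i) (v i) (v k) (v l) := by
    intro i k l
    rw [bracket_self₁, placeBracket, orderSign₄, orderSign_self]
    simp
  have e₂ : ∀ i j l : Fin 8, placeBracket p i j j l = bracket (v i) (v j) (v j) (v l) := by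
    intro i j l
    rw [bracket_self₂, placeBracket, orderSign₄, orderSign_self]
    simp
  have e₃ : ∀ i j k : Fin 8, placeBracket p i j k k = bracket (v i) (v j) (v k) (v k) := by
    intro i j k
    rw [bracket_self₃, placeBracket, orderSign₄, orderSign_self]
    simp
  have h₂ : ∀ i j k l : Fin 8, i < j → j < k →
      placeBracket p i j k l = bracket (v i) (v j) (v k) (v l) := by
    intro i j k l hij hjk
    rcases lt_trichotomy k l with h | rfl | h
    · exact h₃ i j k l hij hjk h
    · exact e₃ i j k
    apply s₃
    rcases lt_trichotomy j l with h' | rfl | h'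
    · exact h₃ i j l k hij h' h
    · exact e₂ i j k
    apply s₂
    rcases lt_trichotomy i l with h'' | rfl | h''
    · exact h₃ i l j k h'' h' hjk
    · exact e₁ i j k
    apply s₁
    exact h₃ l i j k h'' hij hjk
  have h₁ : ∀ i j k l : Fin 8, i < j →
      placeBracket p i j k l = bracket (v i) (v j) (v k) (v l) := by
    intro i j k l hij
    rcases lt_trichotomy j k with h | rfl | h
    · exact h₂ i j k l hij h
    · exact e₂ i j l
    apply s₂
    rcases lt_trichotomy i k with h' | rfl | h'
    · exact h₂ i k j l h' h
    · exact e₁ i j l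
    apply s₁
    exact h₂ k i j l h' hij
  intro i j k l
  rcases lt_trichotomy i j with h | rfl | h
  · exact h₁ i j k l h
  · exact e₁ i k l
  · exact s₁ i j k l (h₁ j i k l h)

theorem IsPlucker.exchange {p : ℕ → R} (hp : IsPlucker p) (x y z t a b c d : Fin 8) :
    placeBracket p x y z t * placeBracket p a b c d =
      placeBracket p x y z a * placeBracket p t b c d +
      placeBracket p x y z b * placeBracket p a t c d +
      placeBracket p x y z c * placeBracket p a b t d +
      placeBracket p x y z d * placeBracket p a b c t := by
  obtain ⟨v, hv⟩ := hp.exists_placeBracket_eq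
  simp only [hv]
  exact bracket_exchange _ _ _ _ _ _ _ _

/-- An exchange relation between brackets that share `i` and `j`: two of its four terms have a
repeated vector and vanish. -/
theorem IsPlucker.three_term {p : ℕ → R} (hp : IsPlucker p) {a b c d i j : Fin 8} (hab : a < b)
    (hbc : b < c) (hcd : c < d) (hi : i ≠ a ∧ i ≠ b ∧ i ≠ c ∧ i ≠ d)
    (hj : j ≠ a ∧ j ≠ b ∧ j ≠ c ∧ j ≠ d) (hij : i ≠ j) :
    p (placeSet i j a c) * p (placeSet i j b d) =
      p (placeSet i j a b) * p (placeSet i j c d) +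
        p (placeSet i j a d) * p (placeSet i j b c) := by
  obtain ⟨v, hv⟩ := hp.exists_placeBracket_eq
  have key : placeBracket p i j a c * placeBracket p i j b d =
      placeBracket p i j a b * placeBracket p i j c d +
        placeBracket p i j a d * placeBracket p i j b c := by
    simp only [hv]
    have := bracket_exchange (v i) (v j) (v a) (v c) (v i) (v j) (v b) (v d)
    rw [this, bracket_self₄, bracket_self₅]
    ring
  have sq : ∀ x y : Fin 8, x ≠ y → (orderSign x y : R) * orderSign x y = 1 := by
    intro x y h
    have : orderSign x y * orderSign x y = 1 := by
      revert x y; decide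
    rw [← Int.cast_mul, this, Int.cast_one]
  have hac := hab.trans hbc
  have hbd := hbc.trans hcd
  have had := hab.trans hbd
  simp only [placeBracket, orderSign₄, orderSign_of_lt hab, orderSign_of_lt hac,
    orderSign_of_lt had, orderSign_of_lt hbc, orderSign_of_lt hbd, orderSign_of_lt hcd,
    Int.cast_mul, mul_one] at key
  -- In each of the three products `i` and `j` are compared once with each of `a`, `b`, `c`, `d`.
  -- All products thus carry the same sign `T`, wherever `i` and `j` lie.
  set T : R := (orderSign i j * orderSign i j) * ((orderSign i a * orderSign i b) *
    (orderSign i c * orderSign i d)) * ((orderSign j a * orderSign j b) *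
    (orderSign j c * orderSign j d)) with hT
  have hT' : T * T = 1 := by
    have : T * T = ((orderSign i j * orderSign i j) * (orderSign i j * orderSign i j)) *
        ((orderSign i a * orderSign i a) * (orderSign i b * orderSign i b) *
          (orderSign i c * orderSign i c) * (orderSign i d * orderSign i d)) *
        ((orderSign j a * orderSign j a) * (orderSign j b * orderSign j b) *
          (orderSign j c * orderSign j c) * (orderSign j d * orderSign j d)) := by
      rw [hT]; ring
    rw [this, sq i j hij, sq i a hi.1, sq i b hi.2.1, sq i c hi.2.2.1, sq i d hi.2.2.2,
      sq j a hj.1, sq j b hj.2.1, sq j c hj.2.2.1, sq j d hj.2.2.2]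
    norm_num
  have key' : T * (p (placeSet i j a c) * p (placeSet i j b d)) =
      T * (p (placeSet i j a b) * p (placeSet i j c d) +
        p (placeSet i j a d) * p (placeSet i j b c)) := by
    rw [hT]
    linear_combination key
  calc _ = T * T * (p (placeSet i j a c) * p (placeSet i j b d)) := by rw [hT', one_mul]
    _ = _ := by rw [mul_assoc, key', ← mul_assoc, hT', one_mul]

/-- The cyclic shift of a set of places. -/
def rotatePlaces (m : ℕ) : ℕ := 2 * m % 256 + m / 128

/-- The reversal of a set of places. -/
def reversePlaces (m : ℕ) : ℕ :=
  (List.range 8).foldr (fun i k => k + m / 2 ^ i % 2 * 2 ^ (7 - i)) 0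

theorem rotatePlaces_placeSet : ∀ i j k l : Fin 8, i < j → j < k → k < l →
    rotatePlaces (placeSet i j k l) = placeSet (i + 1) (j + 1) (k + 1) (l + 1) := by
  decide +kernel

theorem reversePlaces_placeSet : ∀ i j k l : Fin 8, i < j → j < k → k < l →
    reversePlaces (placeSet i j k l) = placeSet l.rev k.rev j.rev i.rev := by
  decide +kernel

theorem IsPlucker.rotate {p : ℕ → R} (hp : IsPlucker p) :
    IsPlucker (fun m => p (rotatePlaces m)) := by
  obtain ⟨v, hv⟩ := hp
  -- Moving the last of four vectors to the front is an odd permutation; the sign of the vector that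
  -- wraps around makes up for it.
  refine ⟨fun i => if i = 7 then -v 0 else v (i + 1), fun i j k l hij hjk hkl => ?_⟩
  dsimp only
  rw [rotatePlaces_placeSet i j k l hij hjk hkl]
  have hk : k ≠ 7 := by omega
  have hj : j ≠ 7 := by omega
  have hi : i ≠ 7 := by omega
  rw [if_neg hi, if_neg hj, if_neg hk]
  split_ifs with hl
  · subst hl
    rw [show placeSet (i + 1) (j + 1) (k + 1) (7 + 1) = placeSet 0 (i + 1) (j + 1) (k + 1) by
      rw [placeSet, placeSet, show (7 + 1 : Fin 8) = 0 from rfl]; ring]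
    rw [hv 0 (i + 1) (j + 1) (k + 1) (by omega) (by omega) (by omega)]
    simp only [bracket, Pi.neg_apply]
    ring
  · exact hv _ _ _ _ (by omega) (by omega) (by omega)

/-- Reversing four vectors is an even permutation, so no sign has to be corrected. -/
theorem IsPlucker.reverse {p : ℕ → R} (hp : IsPlucker p) :
    IsPlucker (fun m => p (reversePlaces m)) := by
  obtain ⟨v, hv⟩ := hp
  refine ⟨fun i => v i.rev, fun i j k l hij hjk hkl => ?_⟩
  dsimp only
  rw [reversePlaces_placeSet i j k l hij hjk hkl,
    hv _ _ _ _ (Fin.rev_lt_rev.mpr hkl) (Fin.rev_lt_rev.mpr hjk) (Fin.rev_lt_rev.mpr hij)]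
  simp only [bracket]
  ring

end Plucker

/-! ### Relations between Plücker coordinates -/

section Relations

variable {R : Type*} [CommRing R]

/-- The value of a single coordinate, or of a difference of products of two coordinates. -/
def atomValue (p : ℕ → R) : List ℕ → R
  | [a] => p a
  | [a, b, c, d] => p a * p b - p c * p d
  | _ => 0

/-- A relation `divisor * target = terms`, where `terms` is a sum of products. -/
structure PlaceRelation where
  divisor : List ℕ
  target : List ℕ
  terms : List (List (List ℕ))

namespace PlaceRelation

/-- The relation holds for `p`. -/
def Holds (r : PlaceRelation) (p : ℕ → R) : Prop :=
  atomValue p r.divisor * atomValue p r.target =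
    (r.terms.map fun t => (t.map (atomValue p)).prod).sum

/-- Exchange the two factors on the left. -/
def swap (r : PlaceRelation) : PlaceRelation := ⟨r.target, r.divisor, r.terms⟩

/-- The image of a relation under a map of sets of places. -/
def map (g : ℕ → ℕ) (r : PlaceRelation) : PlaceRelation :=
  ⟨r.divisor.map g, r.target.map g, r.terms.map (List.map (List.map g))⟩

end PlaceRelation

/-- Relations from which others arise by the symmetries of the octagon. -/
def basicRelations : List PlaceRelation := [
  ⟨[99], [78, 178, 142, 114], [[[195], [46], [114]], [[226], [51, 78, 15, 114]]]⟩,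
  ⟨[39], [51, 78, 15, 114], [[[15], [99], [54]], [[71], [51], [46]]]⟩,
  ⟨[27], [147, 204, 195, 156], [[[15], [147], [216]], [[139], [83, 156, 147, 92]]]⟩,
  ⟨[23], [83, 45, 99, 29], [[[15], [83], [53]], [[71], [51], [29]]]⟩,
  ⟨[23], [51, 78, 15, 114], [[[15], [83], [54]], [[71], [51], [30]]]⟩,
  ⟨[83], [78, 178, 142, 114], [[[195], [30], [114]], [[210], [51, 78, 15, 114]]]⟩,
  ⟨[23], [147, 204, 195, 156], [[[15], [147], [212]], [[135], [83, 156, 147, 92]]]⟩,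
  ⟨[43], [204], [[[15], [232]], [[75, 172, 139, 108]]]⟩,
  ⟨[77], [39, 212, 23, 228], [[[15], [197], [116]], [[71], [77, 180, 141, 116]]]⟩,
  ⟨[43], [83, 45, 99, 29], [[[15], [99], [57]], [[75], [51], [45]]]⟩,
  ⟨[139], [85, 142, 15, 212], [[[135], [153, 78, 201, 30]], [[141], [147, 78, 195, 30]]]⟩,
  -- This relation and the one for `[23]` and `[170]` hold by the definition of the difference; as
  -- rules they recover a coordinate from a difference already known.
  ⟨[39], [153], [[[135], [57]], [[39, 153, 135, 57]]]⟩,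
  ⟨[43], [57, 78, 15, 120], [[[15], [105], [58]], [[75], [57], [46]]]⟩,
  ⟨[23], [170], [[[15], [178]], [[23, 170, 15, 178]]]⟩,
  ⟨[27], [169, 78, 201, 46], [[[15], [105, 154, 27, 232]], [[139], [105], [30]]]⟩,
  ⟨[43], [51, 78, 15, 114], [[[15], [99], [58]], [[75], [51], [46]]]⟩,
  ⟨[23], [75, 212, 71, 216], [[[15], [83], [212]], [[71], [83, 156, 147, 92]]]⟩,
  -- The codes `170` and `85` are those of the odd and of the even places.
  ⟨[170], [85], [[[57], [198]], [[46], [209]], [[150], [105]], [[172], [83]], [[120], [135]]]⟩]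

/-- Apart from two tautologies, each relation is a combination of exchange relations, with signs or
signed coordinates as multipliers chosen so that all unwanted products cancel. -/
theorem IsPlucker.holds_basicRelations {p : ℕ → R} (hp : IsPlucker p) :
    ∀ r ∈ basicRelations, r.Holds p := by
  simp only [basicRelations, List.forall_mem_cons, PlaceRelation.Holds, atomValue, List.map,
    List.prod_cons, List.prod_nil, List.sum_cons, List.sum_nil, mul_one, add_zero]
  refine ⟨?_, ?_, ?_, ?_, ?_, ?_, ?_, ?_, ?_, ?_, ?_, ?_, ?_, ?_, ?_, ?_, ?_, ?_, by simp⟩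
  · have h0 := hp.exchange 1 2 3 0 1 5 6 7
    have h1 := hp.exchange 1 4 5 0 1 5 6 7
    simp [placeBracket, orderSign₄, orderSign, placeSet] at h0 h1
    linear_combination -1 * p 114 * h0 + p 78 * h1
  · have h0 := hp.exchange 1 2 5 0 1 4 5 6
    have h1 := hp.exchange 1 2 3 0 1 2 5 6
    simp [placeBracket, orderSign₄, orderSign, placeSet] at h0 h1
    linear_combination p 15 * h0 + p 51 * h1
  · have h0 := hp.exchange 0 1 3 2 3 4 6 7
    have h1 := hp.exchange 0 1 4 3 0 1 6 7
    simp [placeBracket, orderSign₄, orderSign, placeSet] at h0 h1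
    linear_combination p 147 * h0 + p 156 * h1
  · have h0 := hp.exchange 0 2 3 1 0 2 4 5
    have h1 := hp.exchange 0 1 4 2 0 1 5 6
    simp [placeBracket, orderSign₄, orderSign, placeSet] at h0 h1
    linear_combination -1 * p 83 * h0 + p 29 * h1
  · have h0 := hp.exchange 1 2 4 0 1 4 5 6
    have h1 := hp.exchange 1 2 3 0 1 2 4 6
    simp [placeBracket, orderSign₄, orderSign, placeSet] at h0 h1
    linear_combination p 15 * h0 + p 51 * h1
  · have h0 := hp.exchange 1 2 3 0 1 4 6 7
    have h1 := hp.exchange 1 4 5 0 1 4 6 7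
    simp [placeBracket, orderSign₄, orderSign, placeSet] at h0 h1
    linear_combination -1 * p 114 * h0 + p 78 * h1
  · have h0 := hp.exchange 0 1 2 3 2 4 6 7
    have h1 := hp.exchange 0 1 4 2 0 1 6 7
    simp [placeBracket, orderSign₄, orderSign, placeSet] at h0 h1
    linear_combination -1 * p 147 * h0 + p 156 * h1
  · have h0 := hp.exchange 0 1 3 2 3 5 6 7
    simp [placeBracket, orderSign₄, orderSign, placeSet] at h0
    linear_combination h0
  · have h0 := hp.exchange 0 1 2 4 2 5 6 7
    have h1 := hp.exchange 0 2 3 1 0 2 6 7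
    simp [placeBracket, orderSign₄, orderSign, placeSet] at h0 h1
    linear_combination -1 * p 77 * h0 + -1 * p 116 * h1
  · have h0 := hp.exchange 0 2 3 1 0 3 4 5
    have h1 := hp.exchange 0 1 4 3 0 1 5 6
    simp [placeBracket, orderSign₄, orderSign, placeSet] at h0 h1
    linear_combination -1 * p 99 * h0 + p 45 * h1
  · have h0 := hp.exchange 1 2 3 0 2 4 6 7
    have h1 := hp.exchange 0 2 7 1 0 3 4 7
    have h2 := hp.exchange 0 2 7 1 0 3 6 7
    simp [placeBracket, orderSign₄, orderSign, placeSet] at h0 h1 h2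
    linear_combination p 139 * h0 + -1 * p 78 * h1 + p 30 * h2
  · ring
  · have h0 := hp.exchange 1 3 5 0 3 4 5 6
    have h1 := hp.exchange 1 2 3 0 1 3 5 6
    simp [placeBracket, orderSign₄, orderSign, placeSet] at h0 h1
    linear_combination p 15 * h0 + p 57 * h1
  · ring
  · have h0 := hp.exchange 1 2 3 0 3 5 6 7
    have h1 := hp.exchange 1 2 3 0 1 3 4 7
    simp [placeBracket, orderSign₄, orderSign, placeSet] at h0 h1
    linear_combination -1 * p 27 * h0 + p 105 * h1
  · have h0 := hp.exchange 1 3 5 0 1 4 5 6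
    have h1 := hp.exchange 1 2 3 0 1 3 5 6
    simp [placeBracket, orderSign₄, orderSign, placeSet] at h0 h1
    linear_combination p 15 * h0 + p 51 * h1
  · have h0 := hp.exchange 0 1 4 2 3 4 6 7
    have h1 := hp.exchange 0 1 3 2 0 1 4 6
    simp [placeBracket, orderSign₄, orderSign, placeSet] at h0 h1
    linear_combination p 71 * h0 + p 212 * h1
  · have h0 := hp.exchange 1 4 6 0 2 3 5 7
    have h1 := hp.exchange 0 3 5 1 2 4 6 7
    have h2 := hp.exchange 1 3 5 0 2 4 6 7
    have h3 := hp.exchange 0 2 7 1 3 4 5 6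
    simp [placeBracket, orderSign₄, orderSign, placeSet] at h0 h1 h2 h3
    linear_combination h0 + h1 + h2 + -1 * h3

end Relations

/-! ### Rules for positive Laurent polynomials -/

section Rules

open ChamberSearch

theorem IsPlucker.rotate_iterate {R : Type*} [CommRing R] {p : ℕ → R} (hp : IsPlucker p) (k : ℕ) :
    IsPlucker (fun m => p (rotatePlaces^[k] m)) := by
  induction k with
  | zero => exact hp
  | succ k ih => exact ih.rotate

/-- The symmetries of the octagon, acting on sets of places. -/
def octagonSymmetries : List (ℕ → ℕ) :=
  (List.range 8).flatMap fun k => [rotatePlaces^[k], fun m => rotatePlaces^[k] (reversePlaces m)]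

theorem IsPlucker.comp_symmetry {R : Type*} [CommRing R] {p : ℕ → R} (hp : IsPlucker p)
    {g : ℕ → ℕ} (hg : g ∈ octagonSymmetries) : IsPlucker (fun m => p (g m)) := by
  simp only [octagonSymmetries, List.mem_flatMap, List.mem_cons, List.not_mem_nil, or_false] at hg
  obtain ⟨k, -, rfl | rfl⟩ := hg
  · exact hp.rotate_iterate k
  · exact (hp.rotate_iterate k).reverse

/-- Order the factors in the products of a difference of products. -/
def normalizeAtom : List ℕ → List ℕ
  | [a, b, c, d] => [min a b, max a b, min c d, max c d]
  | l => l

/-- The differences of products that occur in the relations. -/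
def quadTable : List (List ℕ) :=
  [[39, 89, 71, 57], [51, 201, 195, 57], [39, 201, 15, 225], [83, 45, 99, 29],
    [85, 58, 83, 60]].flatMap fun q => octagonSymmetries.map fun g => normalizeAtom (q.map g)

/-- The place of a coordinate or of a difference of products in a lane. -/
def atomIndex : List ℕ → ℕ
  | [a] => a
  | l => 256 + quadTable.idxOf (normalizeAtom l)

/-- The atom has a place. -/
def hasIndex : List ℕ → Bool
  | [a] => a.blt 256
  | l => quadTable.contains (normalizeAtom l)

/-- The relations that are used for rules. -/
def allRelations : List PlaceRelation :=
  -- Reading a relation backwards makes its target the divisor. This is of use only for a single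
  -- coordinate, since divisors are looked up among the chamber minors.
  (basicRelations ++ (basicRelations.filter fun r : PlaceRelation =>
    r.target.length == 1).map PlaceRelation.swap).flatMap fun r : PlaceRelation =>
       octagonSymmetries.map fun g => r.map g

/-- The rule that belongs to a relation. -/
def PlaceRelation.laneRule (r : PlaceRelation) : LaneRule :=
  ⟨atomIndex r.divisor, atomIndex r.target, r.terms.flatten.map atomIndex, 1⟩

/-- All atoms of the relation have places. -/
def PlaceRelation.hasIndices (r : PlaceRelation) : Bool :=
  hasIndex r.divisor && hasIndex r.target && r.terms.flatten.all hasIndex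

/-- The shifts by two places other than the given ones. -/
def pairShifts (a b c d : ℕ) : List ℕ :=
  (List.range 8).flatMap fun i => (List.range i).flatMap fun j =>
    if i ∈ [a, b, c, d] ∨ j ∈ [a, b, c, d] then [] else [2 ^ i + 2 ^ j]

/-- The rules that belong to the three-term relations for four given places. -/
def threeTermRulesAt (a b c d : ℕ) : List LaneRule :=
  let need := [2 ^ a + 2 ^ b, 2 ^ c + 2 ^ d, 2 ^ a + 2 ^ d, 2 ^ b + 2 ^ c]
  [⟨2 ^ a + 2 ^ c, 2 ^ b + 2 ^ d, need, bits (pairShifts a b c d)⟩,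
    ⟨2 ^ b + 2 ^ d, 2 ^ a + 2 ^ c, need, bits (pairShifts a b c d)⟩]

/-- The rules that belong to the three-term relations. -/
def threeTermRules : List LaneRule :=
  (List.range 8).flatMap fun d => (List.range d).flatMap fun c => (List.range c).flatMap fun b =>
    (List.range b).flatMap fun a => threeTermRulesAt a b c d

/-- The value that belongs to a place in a lane. -/
def placeValue {R : Type*} [CommRing R] (p : ℕ → R) (i : ℕ) : R :=
  if i < 256 then p i else atomValue p (quadTable.getD (i - 256) [])

/-- The rules that belong to the relations. -/
def relationRules : List LaneRule := allRelations.map PlaceRelation.laneRule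

/-- Five functions under sixteen symmetries. Together with 256 places for coordinates they account
for the lane width 336. -/
theorem length_quadTable : quadTable.length = 80 := by
  decide +kernel

theorem hasIndices_of_mem {r : PlaceRelation} (hr : r ∈ allRelations) : r.hasIndices = true := by
  have h : allRelations.all PlaceRelation.hasIndices = true := by decide +kernel
  exact List.all_eq_true.mp h r hr

section Values

variable {R : Type*} [CommRing R]

theorem atomValue_map (p : ℕ → R) (g : ℕ → ℕ) :
    ∀ l : List ℕ, atomValue p (l.map g) = atomValue (fun m => p (g m)) l
  | [] => rfl
  | [_] => rfl
  | [_, _] => rfl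
  | [_, _, _] => rfl
  | [_, _, _, _] => rfl
  | _ :: _ :: _ :: _ :: _ :: _ => rfl

theorem apply_min_mul_apply_max (p : ℕ → R) (a b : ℕ) : p (min a b) * p (max a b) = p a * p b := by
  rcases le_total a b with h | h
  · rw [min_eq_left h, max_eq_right h]
  · rw [min_eq_right h, max_eq_left h, mul_comm]

theorem atomValue_normalizeAtom (p : ℕ → R) :
    ∀ l : List ℕ, atomValue p (normalizeAtom l) = atomValue p l
  | [] => rfl
  | [_] => rfl
  | [_, _] => rfl
  | [_, _, _] => rfl
  | [a, b, c, d] => by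
    change p (min a b) * p (max a b) - p (min c d) * p (max c d) = _
    rw [apply_min_mul_apply_max, apply_min_mul_apply_max]
    rfl
  | _ :: _ :: _ :: _ :: _ :: _ => rfl

theorem placeValue_of_lt (p : ℕ → R) {i : ℕ} (hi : i < 256) : placeValue p i = p i := if_pos hi

theorem placeValue_idxOf (p : ℕ → R) {l : List ℕ}
    (h : quadTable.contains (normalizeAtom l) = true) :
    256 + quadTable.idxOf (normalizeAtom l) < 336 ∧
      placeValue p (256 + quadTable.idxOf (normalizeAtom l)) = atomValue p l := by
  have h1 : quadTable.idxOf (normalizeAtom l) < quadTable.length :=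
    List.idxOf_lt_length_of_mem (List.contains_iff_mem.mp h)
  refine ⟨by rw [length_quadTable] at h1; omega, ?_⟩
  rw [placeValue, if_neg (by omega), Nat.add_sub_cancel_left, List.getD_eq_getElem _ _ h1,
    List.getElem_idxOf, atomValue_normalizeAtom]

theorem placeValue_atomIndex (p : ℕ → R) : ∀ {l : List ℕ}, hasIndex l = true →
    atomIndex l < 336 ∧ placeValue p (atomIndex l) = atomValue p l
  | [], h => placeValue_idxOf p h
  | [a], h => by
    have ha : a < 256 := Nat.blt_eq.mp h
    exact ⟨ha.trans (by norm_num), placeValue_of_lt p ha⟩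
  | _ :: _ :: _, h => placeValue_idxOf p h

theorem PlaceRelation.holds_map_iff {p : ℕ → R} {g : ℕ → ℕ} {r : PlaceRelation} :
    (r.map g).Holds p ↔ r.Holds (fun m => p (g m)) := by
  simp only [PlaceRelation.Holds, PlaceRelation.map, atomValue_map, List.map_map,
    Function.comp_def]

theorem PlaceRelation.Holds.swap {p : ℕ → R} {r : PlaceRelation} (h : r.Holds p) :
    r.swap.Holds p :=
  (mul_comm _ _).trans h

theorem IsPlucker.holds_allRelations {p : ℕ → R} (hp : IsPlucker p) {r : PlaceRelation}
    (hr : r ∈ allRelations) : r.Holds p := by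
  simp only [allRelations, List.mem_flatMap, List.mem_map, List.mem_append, List.mem_filter] at hr
  obtain ⟨r', hr', g, hg, rfl⟩ := hr
  rw [PlaceRelation.holds_map_iff]
  have hpg := (hp.comp_symmetry hg).holds_basicRelations
  rcases hr' with hr' | ⟨r'', hr'', rfl⟩
  · exact hpg _ hr'
  · exact (hpg _ hr''.1).swap

end Values

section Soundness

variable {n : ℕ} {L : Set (MinorIndex n)}
  {p : ∀ (K : Type u) [Field K], Matrix (Fin n) (Fin n) K → ℕ → K}

/-- These rules name their places outright: the mask `1` allows the shift `0` only. -/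
theorem isSound_relationRules {W : ℕ} (hW : 336 ≤ W)
    (hp : ∀ (K : Type u) [Field K] (M : Matrix (Fin n) (Fin n) K), IsPlucker (p K M)) :
    ∀ r ∈ relationRules, r.IsSound W
      (fun i => IsPositiveLaurentUnit L (fun K _ M => placeValue (p K M) i))
      (fun i => IsPositiveLaurent L (fun K _ M => placeValue (p K M) i)) := by
  intro r hr
  obtain ⟨r, hr', rfl⟩ := List.mem_map.mp hr
  have hi := hasIndices_of_mem hr'
  simp only [PlaceRelation.hasIndices, Bool.and_eq_true, List.all_eq_true] at hi
  obtain ⟨⟨hd, ht⟩, hn⟩ := hi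
  have hlt : ∀ {l}, hasIndex l = true → atomIndex l < W := fun h =>
    (placeValue_atomIndex (fun _ => (0 : ℤ)) h).1.trans_le hW
  refine ⟨Nat.one_lt_two_pow (by omega), fun s hs => ?_⟩
  obtain rfl : s = 0 := by
    by_contra h
    rw [show r.laneRule.mask = 2 ^ 0 from rfl, Nat.testBit_two_pow_of_ne (Ne.symm h)] at hs
    exact Bool.false_ne_true hs
  simp only [zero_add]
  refine ⟨hlt hd, hlt ht, ?_, fun hA hG => ?_⟩
  · intro i hi
    obtain ⟨l, hl, rfl⟩ := List.mem_map.mp hi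
    exact hlt (hn l hl)
  · refine IsPositiveLaurent.of_mul_eq hA (χ := fun K _ M =>
      (r.terms.map fun t => (t.map (atomValue (p K M))).prod).sum) ?_ fun K _ M => ?_
    · refine IsPositiveLaurent.list_sum (F := fun (t : List (List ℕ)) K _ M =>
          (t.map (atomValue (p K M))).prod)
        fun t ht => IsPositiveLaurent.list_prod
        (F := fun (l : List ℕ) K _ M => atomValue (p K M) l)
        fun l hl => ?_
      have hl' : l ∈ r.terms.flatten := List.mem_flatten.mpr ⟨t, ht, hl⟩
      exact (hG _ (List.mem_map_of_mem hl')).congr fun K _ M _ =>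
        (placeValue_atomIndex (p K M) (hn l hl')).2.symm
    · exact (congrArg₂ (· * ·) (placeValue_atomIndex (p K M) hd).2
        (placeValue_atomIndex (p K M) ht).2).trans ((hp K M).holds_allRelations hr')

theorem mem_pairShifts {a b c d s : ℕ} : s ∈ pairShifts a b c d ↔ ∃ i < 8, ∃ j < i,
    ¬(i ∈ [a, b, c, d] ∨ j ∈ [a, b, c, d]) ∧ s = 2 ^ i + 2 ^ j := by
  simp only [pairShifts, List.mem_flatMap, List.mem_range]
  refine exists_congr fun i => and_congr_right fun _ => exists_congr fun j =>
    and_congr_right fun _ => ?_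
  split_ifs with h
  · exact iff_of_false List.not_mem_nil fun h' => h'.1 h
  · rw [List.mem_singleton]
    exact ⟨fun e => ⟨h, e⟩, And.right⟩

theorem placeSet_lt : ∀ i j k l : Fin 8, [i, j, k, l].Nodup → placeSet i j k l < 256 := by
  decide +kernel

/-- The shift is the code of the two places common to all coordinates of a three-term relation, so
one rule serves all pairs disjoint from `a`, `b`, `c`, `d`. The two rules differ in which factor on
the left is the divisor. -/
theorem isSound_threeTermRules {W : ℕ} (hW : 256 ≤ W)
    (hp : ∀ (K : Type u) [Field K] (M : Matrix (Fin n) (Fin n) K), IsPlucker (p K M)) :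
    ∀ r ∈ threeTermRules, r.IsSound W
      (fun i => IsPositiveLaurentUnit L (fun K _ M => placeValue (p K M) i))
      (fun i => IsPositiveLaurent L (fun K _ M => placeValue (p K M) i)) := by
  intro r hr
  simp only [threeTermRules, List.mem_flatMap, List.mem_range] at hr
  obtain ⟨d, hd, c, hc, b, hb, a, ha, hr⟩ := hr
  have hmask : bits (pairShifts a b c d) < 2 ^ W := by
    refine lt_of_lt_of_le (Nat.lt_pow_two_of_testBit _ fun s hs => ?_)
      (Nat.pow_le_pow_right two_pos hW)
    rw [← Bool.not_eq_true, testBit_bits, mem_pairShifts]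
    rintro ⟨i, hi, j, hj, -, rfl⟩
    have h1 : 2 ^ i ≤ 2 ^ 7 := Nat.pow_le_pow_right two_pos (by omega)
    have h2 : 2 ^ j < 2 ^ i := Nat.pow_lt_pow_right one_lt_two hj
    omega
  have key : ∀ s, (bits (pairShifts a b c d)).testBit s = true →
      ∃ a' b' c' d' i j : Fin 8, (a'.val = a ∧ b'.val = b ∧ c'.val = c ∧ d'.val = d) ∧
        (a' < b' ∧ b' < c' ∧ c' < d') ∧ (i ≠ a' ∧ i ≠ b' ∧ i ≠ c' ∧ i ≠ d') ∧
        (j ≠ a' ∧ j ≠ b' ∧ j ≠ c' ∧ j ≠ d') ∧ i ≠ j ∧ s = 2 ^ i.val + 2 ^ j.val := by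
    intro s hs
    rw [testBit_bits, mem_pairShifts] at hs
    obtain ⟨i, hi, j, hj, hij, rfl⟩ := hs
    simp only [List.mem_cons, List.not_mem_nil, or_false, not_or] at hij
    refine ⟨⟨a, by omega⟩, ⟨b, by omega⟩, ⟨c, by omega⟩, ⟨d, hd⟩, ⟨i, hi⟩, ⟨j, by omega⟩,
      ⟨rfl, rfl, rfl, rfl⟩, ⟨ha, hb, hc⟩, ?_, ?_, ?_, rfl⟩
    · simpa only [ne_eq, Fin.mk.injEq] using hij.1
    · simpa only [ne_eq, Fin.mk.injEq] using hij.2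
    · simp only [ne_eq, Fin.mk.injEq]
      omega
  simp only [threeTermRulesAt, List.mem_cons, List.not_mem_nil, or_false] at hr
  rcases hr with rfl | rfl
  all_goals
    refine ⟨hmask, fun s hs => ?_⟩
    obtain ⟨a, b, c, d, i, j, ⟨rfl, rfl, rfl, rfl⟩, ⟨hab, hbc, hcd⟩, hi, hj, hij, rfl⟩ := key s hs
    have hlt : ∀ k l : Fin 8, i ≠ k → i ≠ l → j ≠ k → j ≠ l → k ≠ l →
        2 ^ i.val + 2 ^ j.val + (2 ^ k.val + 2 ^ l.val) < 256 := by
      intro k l h1 h2 h3 h4 h5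
      rw [← add_assoc]
      exact placeSet_lt i j k l (by simp [hij, h1, h2, h3, h4, h5])
    have hac := hlt a c hi.1 hi.2.2.1 hj.1 hj.2.2.1 (hab.trans hbc).ne
    have hbd := hlt b d hi.2.1 hi.2.2.2 hj.2.1 hj.2.2.2 (hbc.trans hcd).ne
    have hab' := hlt a b hi.1 hi.2.1 hj.1 hj.2.1 hab.ne
    have hcd' := hlt c d hi.2.2.1 hi.2.2.2 hj.2.2.1 hj.2.2.2 hcd.ne
    have had := hlt a d hi.1 hi.2.2.2 hj.1 hj.2.2.2 (hab.trans (hbc.trans hcd)).ne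
    have hbc' := hlt b c hi.2.1 hi.2.2.1 hj.2.1 hj.2.2.1 hbc.ne
    simp only [List.forall_mem_cons, List.not_mem_nil, IsEmpty.forall_iff, implies_true, and_true]
    refine ⟨by omega, by omega, by omega, fun hA hG => ?_⟩
    obtain ⟨g1, g2, g3, g4⟩ := hG
    refine IsPositiveLaurent.of_mul_eq hA ((g1.mul g2).add (g3.mul g4)) fun K _ M => ?_
    rw [placeValue_of_lt _ hac, placeValue_of_lt _ hbd, placeValue_of_lt _ hab',
      placeValue_of_lt _ hcd', placeValue_of_lt _ had, placeValue_of_lt _ hbc']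
    have h3 := (hp K M).three_term hab hbc hcd hi hj hij
    simp only [placeSet, add_assoc] at h3 ⊢
    linear_combination h3

end Soundness

end Rules

/-! ### Minors as Plücker coordinates -/

section Minors

/-- The columns of the block sum of `M` and an identity matrix of total size `4`, and the signed
unit vectors in reverse order. -/
def paddedVector {n : ℕ} {R : Type*} [CommRing R] (M : Matrix (Fin n) (Fin n) R) (k : Fin 8)
    (i : Fin 4) : R :=
  if k.val < 4 then
    if h : i.val < n ∧ k.val < n then M ⟨i, h.1⟩ ⟨k, h.2⟩ else if i.val = k.val then 1 else 0
  else if i.val + k.val = 7 then (-1) ^ (i.val + 1) else 0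

/-- The determinants of four padded vectors. -/
def paddedCoordinate {n : ℕ} {R : Type*} [CommRing R] (M : Matrix (Fin n) (Fin n) R) (m : ℕ) : R :=
  match (List.finRange 8).filter fun i => m.testBit i.val with
  | [i, j, k, l] =>
    bracket (paddedVector M i) (paddedVector M j) (paddedVector M k) (paddedVector M l)
  | _ => 0

theorem filter_testBit_placeSet : ∀ i j k l : Fin 8, i < j → j < k → k < l →
    ((List.finRange 8).filter fun t => (placeSet i j k l).testBit t.val) = [i, j, k, l] := by
  decide +kernel

variable {n : ℕ} {R : Type*} [CommRing R]

theorem paddedCoordinate_placeSet (M : Matrix (Fin n) (Fin n) R) {i j k l : Fin 8} (hij : i < j)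
    (hjk : j < k) (hkl : k < l) : paddedCoordinate M (placeSet i j k l) =
      bracket (paddedVector M i) (paddedVector M j) (paddedVector M k) (paddedVector M l) := by
  rw [paddedCoordinate, filter_testBit_placeSet i j k l hij hjk hkl]

theorem isPlucker_paddedCoordinate (M : Matrix (Fin n) (Fin n) R) :
    IsPlucker (paddedCoordinate M) :=
  ⟨paddedVector M, fun _ _ _ _ => paddedCoordinate_placeSet M⟩

/-- Once the rows are given by an explicit list, the size of the minor is a numeral and its
determinant can be expanded; the columns stay arbitrary. -/
theorem exists_columns {k : ℕ} (D : MinorIndex n) (r : Fin k → Fin n) (hr : StrictMono r)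
    (hD : D.rows = Finset.univ.image r) :
    ∃ c : Fin k → Fin n, StrictMono c ∧
      D.code = rowCode (Finset.univ.image r) + (∑ x, 2 ^ (c x).val + (16 - 2 ^ n)) ∧
        ∀ M : Matrix (Fin n) (Fin n) R, M.minorAt D = (M.submatrix r c).det := by
  have hk : D.rows.card = k := by
    rw [hD, Finset.card_image_of_injective _ hr.injective, Finset.card_univ, Fintype.card_fin]
  subst hk
  refine ⟨D.cols.orderEmbOfFin D.card_eq.symm, OrderEmbedding.strictMono _, ?_, fun M => ?_⟩
  · rw [MinorIndex.code, ← hD, colCode]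
    congr 2
    conv_lhs => rw [← Finset.image_orderEmbOfFin_univ D.cols D.card_eq.symm]
    rw [Finset.sum_image fun _ _ _ _ h => (OrderEmbedding.strictMono _).injective h]
  · rw [Matrix.minorAt, Finset.orderEmbOfFin_unique rfl (fun x => ?_) hr]
    rw [hD]
    exact Finset.mem_image_of_mem r (Finset.mem_univ x)

theorem paddedVector_column (hn : n ≤ 4) (M : Matrix (Fin n) (Fin n) R) (j : Fin n) (h : j.val < 8)
    (i : Fin 4) : paddedVector M ⟨j, h⟩ i = if hi : i.val < n then M ⟨i, hi⟩ j else 0 := by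
  rw [paddedVector, if_pos (j.isLt.trans_le hn)]
  by_cases hi : i.val < n
  · rw [dif_pos ⟨hi, j.isLt⟩, dif_pos hi]
  · rw [dif_neg fun h => hi h.1, dif_neg hi, if_neg (show ¬ i.val = j.val by omega)]

theorem Matrix.det_fin_four (A : Matrix (Fin 4) (Fin 4) R) : A.det =
    bracket (fun i => A i 0) (fun i => A i 1) (fun i => A i 2) (fun i => A i 3) := by
  rw [Matrix.det_succ_row_zero]
  simp [Fin.sum_univ_succ, Matrix.det_fin_three, bracket, Fin.succAbove]
  ring

theorem paddedCoordinate_code_zero (M : Matrix (Fin 0) (Fin 0) R) (D : MinorIndex 0) :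
    paddedCoordinate M D.code = M.minorAt D := by
  have h : ∀ s : Finset (Fin 0), s ∈
      [Finset.univ.image ![]] := by
    decide +kernel
  have h := h D.rows
  simp only [List.mem_cons, List.not_mem_nil, or_false] at h
  obtain ⟨c, hc, hcode, hdet⟩ := exists_columns (R := R) D ![] (by decide) h
  rw [show D.code = placeSet 0 1 2 3 by
      rw [hcode, show rowCode (Finset.univ.image ![] : Finset (Fin 0)) = 0 from rfl]
      simp [placeSet],
    paddedCoordinate_placeSet M (by decide) (by decide) (by decide), hdet, Matrix.det_fin_zero]
  simp only [bracket]
  simp [paddedVector]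

theorem paddedCoordinate_code_one (M : Matrix (Fin 1) (Fin 1) R) (D : MinorIndex 1) :
    paddedCoordinate M D.code = M.minorAt D := by
  have h : ∀ s : Finset (Fin 1), s ∈
      [Finset.univ.image ![], Finset.univ.image ![0]] := by
    decide +kernel
  have h := h D.rows
  simp only [List.mem_cons, List.not_mem_nil, or_false] at h
  rcases h with h | h
  · obtain ⟨c, hc, hcode, hdet⟩ := exists_columns (R := R) D ![] (by decide) h
    rw [show D.code = placeSet 1 2 3 7 by
        rw [hcode, show rowCode (Finset.univ.image ![] : Finset (Fin 1)) = 128 from rfl]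
        simp [placeSet],
      paddedCoordinate_placeSet M (by decide) (by decide) (by decide), hdet, Matrix.det_fin_zero]
    simp only [bracket]
    simp [paddedVector]
  · obtain ⟨c, hc, hcode, hdet⟩ := exists_columns (R := R) D ![0] (by decide) h
    rw [show D.code = placeSet ⟨c 0, by omega⟩ 1 2 3 by
        rw [hcode, show rowCode (Finset.univ.image ![0] : Finset (Fin 1)) = 0 from rfl]
        simp [placeSet],
      paddedCoordinate_placeSet M (by rw [Fin.lt_def]; change (c 0).val < 1; omega) (by decide) (by decide), hdet, Matrix.det_fin_one]
    simp only [bracket, paddedVector_column (n := 1) (by norm_num)]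
    simp [paddedVector]

theorem paddedCoordinate_code_two (M : Matrix (Fin 2) (Fin 2) R) (D : MinorIndex 2) :
    paddedCoordinate M D.code = M.minorAt D := by
  have h : ∀ s : Finset (Fin 2), s ∈
      [Finset.univ.image ![], Finset.univ.image ![0], Finset.univ.image ![1],
        Finset.univ.image ![0, 1]] := by
    decide +kernel
  have h := h D.rows
  simp only [List.mem_cons, List.not_mem_nil, or_false] at h
  rcases h with h | h | h | h
  · obtain ⟨c, hc, hcode, hdet⟩ := exists_columns (R := R) D ![] (by decide) h
    rw [show D.code = placeSet 2 3 6 7 by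
        rw [hcode, show rowCode (Finset.univ.image ![] : Finset (Fin 2)) = 192 from rfl]
        simp [placeSet],
      paddedCoordinate_placeSet M (by decide) (by decide) (by decide), hdet, Matrix.det_fin_zero]
    simp only [bracket]
    simp [paddedVector]
  · obtain ⟨c, hc, hcode, hdet⟩ := exists_columns (R := R) D ![0] (by decide) h
    rw [show D.code = placeSet ⟨c 0, by omega⟩ 2 3 6 by
        rw [hcode, show rowCode (Finset.univ.image ![0] : Finset (Fin 2)) = 64 from rfl]
        simp [placeSet]
        omega,
      paddedCoordinate_placeSet M (by rw [Fin.lt_def]; change (c 0).val < 2; omega) (by decide) (by decide), hdet, Matrix.det_fin_one]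
    simp only [bracket, paddedVector_column (n := 2) (by norm_num)]
    simp [paddedVector]
  · obtain ⟨c, hc, hcode, hdet⟩ := exists_columns (R := R) D ![1] (by decide) h
    rw [show D.code = placeSet ⟨c 0, by omega⟩ 2 3 7 by
        rw [hcode, show rowCode (Finset.univ.image ![1] : Finset (Fin 2)) = 128 from rfl]
        simp [placeSet]
        omega,
      paddedCoordinate_placeSet M (by rw [Fin.lt_def]; change (c 0).val < 2; omega) (by decide) (by decide), hdet, Matrix.det_fin_one]
    simp only [bracket, paddedVector_column (n := 2) (by norm_num)]
    simp [paddedVector]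
  · obtain ⟨c, hc, hcode, hdet⟩ := exists_columns (R := R) D ![0, 1] (by decide) h
    have h0 : c 0 < c 1 := hc (by decide)
    rw [show D.code = placeSet ⟨c 0, by omega⟩ ⟨c 1, by omega⟩ 2 3 by
        rw [hcode, show rowCode (Finset.univ.image ![0, 1] : Finset (Fin 2)) = 0 from rfl]
        simp [Fin.sum_univ_succ, placeSet],
      paddedCoordinate_placeSet M h0 (by rw [Fin.lt_def]; change (c 1).val < 2; omega) (by decide), hdet, Matrix.det_fin_two]
    simp only [bracket, paddedVector_column (n := 2) (by norm_num)]
    simp [paddedVector]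
    ring

theorem paddedCoordinate_code_three (M : Matrix (Fin 3) (Fin 3) R) (D : MinorIndex 3) :
    paddedCoordinate M D.code = M.minorAt D := by
  have h : ∀ s : Finset (Fin 3), s ∈
      [Finset.univ.image ![], Finset.univ.image ![0], Finset.univ.image ![1],
        Finset.univ.image ![2], Finset.univ.image ![0, 1], Finset.univ.image ![0, 2],
        Finset.univ.image ![1, 2], Finset.univ.image ![0, 1, 2]] := by
    decide +kernel
  have h := h D.rows
  simp only [List.mem_cons, List.not_mem_nil, or_false] at h
  rcases h with h | h | h | h | h | h | h | h
  · obtain ⟨c, hc, hcode, hdet⟩ := exists_columns (R := R) D ![] (by decide) h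
    rw [show D.code = placeSet 3 5 6 7 by
        rw [hcode, show rowCode (Finset.univ.image ![] : Finset (Fin 3)) = 224 from rfl]
        simp [placeSet],
      paddedCoordinate_placeSet M (by decide) (by decide) (by decide), hdet, Matrix.det_fin_zero]
    simp only [bracket]
    simp [paddedVector]
    ring
  · obtain ⟨c, hc, hcode, hdet⟩ := exists_columns (R := R) D ![0] (by decide) h
    rw [show D.code = placeSet ⟨c 0, by omega⟩ 3 5 6 by
        rw [hcode, show rowCode (Finset.univ.image ![0] : Finset (Fin 3)) = 96 from rfl]
        simp [placeSet]
        omega,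
      paddedCoordinate_placeSet M (by rw [Fin.lt_def]; change (c 0).val < 3; omega) (by decide) (by decide), hdet, Matrix.det_fin_one]
    simp only [bracket, paddedVector_column (n := 3) (by norm_num)]
    simp [paddedVector]
    ring
  · obtain ⟨c, hc, hcode, hdet⟩ := exists_columns (R := R) D ![1] (by decide) h
    rw [show D.code = placeSet ⟨c 0, by omega⟩ 3 5 7 by
        rw [hcode, show rowCode (Finset.univ.image ![1] : Finset (Fin 3)) = 160 from rfl]
        simp [placeSet]
        omega,
      paddedCoordinate_placeSet M (by rw [Fin.lt_def]; change (c 0).val < 3; omega) (by decide) (by decide), hdet, Matrix.det_fin_one]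
    simp only [bracket, paddedVector_column (n := 3) (by norm_num)]
    simp [paddedVector]
    ring
  · obtain ⟨c, hc, hcode, hdet⟩ := exists_columns (R := R) D ![2] (by decide) h
    rw [show D.code = placeSet ⟨c 0, by omega⟩ 3 6 7 by
        rw [hcode, show rowCode (Finset.univ.image ![2] : Finset (Fin 3)) = 192 from rfl]
        simp [placeSet]
        omega,
      paddedCoordinate_placeSet M (by rw [Fin.lt_def]; change (c 0).val < 3; omega) (by decide) (by decide), hdet, Matrix.det_fin_one]
    simp only [bracket, paddedVector_column (n := 3) (by norm_num)]
    simp [paddedVector]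
  · obtain ⟨c, hc, hcode, hdet⟩ := exists_columns (R := R) D ![0, 1] (by decide) h
    have h0 : c 0 < c 1 := hc (by decide)
    rw [show D.code = placeSet ⟨c 0, by omega⟩ ⟨c 1, by omega⟩ 3 5 by
        rw [hcode, show rowCode (Finset.univ.image ![0, 1] : Finset (Fin 3)) = 32 from rfl]
        simp [Fin.sum_univ_succ, placeSet]
        omega,
      paddedCoordinate_placeSet M h0 (by rw [Fin.lt_def]; change (c 1).val < 3; omega) (by decide), hdet, Matrix.det_fin_two]
    simp only [bracket, paddedVector_column (n := 3) (by norm_num)]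
    simp [paddedVector]
    ring
  · obtain ⟨c, hc, hcode, hdet⟩ := exists_columns (R := R) D ![0, 2] (by decide) h
    have h0 : c 0 < c 1 := hc (by decide)
    rw [show D.code = placeSet ⟨c 0, by omega⟩ ⟨c 1, by omega⟩ 3 6 by
        rw [hcode, show rowCode (Finset.univ.image ![0, 2] : Finset (Fin 3)) = 64 from rfl]
        simp [Fin.sum_univ_succ, placeSet]
        omega,
      paddedCoordinate_placeSet M h0 (by rw [Fin.lt_def]; change (c 1).val < 3; omega) (by decide), hdet, Matrix.det_fin_two]
    simp only [bracket, paddedVector_column (n := 3) (by norm_num)]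
    simp [paddedVector]
    ring
  · obtain ⟨c, hc, hcode, hdet⟩ := exists_columns (R := R) D ![1, 2] (by decide) h
    have h0 : c 0 < c 1 := hc (by decide)
    rw [show D.code = placeSet ⟨c 0, by omega⟩ ⟨c 1, by omega⟩ 3 7 by
        rw [hcode, show rowCode (Finset.univ.image ![1, 2] : Finset (Fin 3)) = 128 from rfl]
        simp [Fin.sum_univ_succ, placeSet]
        omega,
      paddedCoordinate_placeSet M h0 (by rw [Fin.lt_def]; change (c 1).val < 3; omega) (by decide), hdet, Matrix.det_fin_two]
    simp only [bracket, paddedVector_column (n := 3) (by norm_num)]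
    simp [paddedVector]
    ring
  · obtain ⟨c, hc, hcode, hdet⟩ := exists_columns (R := R) D ![0, 1, 2] (by decide) h
    have h0 : c 0 < c 1 := hc (by decide)
    have h1 : c 1 < c 2 := hc (by decide)
    rw [show D.code = placeSet ⟨c 0, by omega⟩ ⟨c 1, by omega⟩ ⟨c 2, by omega⟩ 3 by
        rw [hcode, show rowCode (Finset.univ.image ![0, 1, 2] : Finset (Fin 3)) = 0 from rfl]
        simp [Fin.sum_univ_succ, placeSet]
        omega,
      paddedCoordinate_placeSet M h0 h1 (by rw [Fin.lt_def]; change (c 2).val < 3; omega), hdet, Matrix.det_fin_three]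
    simp only [bracket, paddedVector_column (n := 3) (by norm_num)]
    simp [paddedVector]
    ring

theorem paddedCoordinate_code_four (M : Matrix (Fin 4) (Fin 4) R) (D : MinorIndex 4) :
    paddedCoordinate M D.code = M.minorAt D := by
  have h : ∀ s : Finset (Fin 4), s ∈
      [Finset.univ.image ![], Finset.univ.image ![0], Finset.univ.image ![1],
        Finset.univ.image ![2], Finset.univ.image ![3], Finset.univ.image ![0, 1],
        Finset.univ.image ![0, 2], Finset.univ.image ![0, 3], Finset.univ.image ![1, 2],
        Finset.univ.image ![1, 3], Finset.univ.image ![2, 3], Finset.univ.image ![0, 1, 2],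
        Finset.univ.image ![0, 1, 3], Finset.univ.image ![0, 2, 3], Finset.univ.image ![1, 2, 3],
        Finset.univ.image ![0, 1, 2, 3]] := by
    decide +kernel
  have h := h D.rows
  simp only [List.mem_cons, List.not_mem_nil, or_false] at h
  rcases h with h | h | h | h | h | h | h | h | h | h | h | h | h | h | h | h
  · obtain ⟨c, hc, hcode, hdet⟩ := exists_columns (R := R) D ![] (by decide) h
    rw [show D.code = placeSet 4 5 6 7 by
        rw [hcode, show rowCode (Finset.univ.image ![] : Finset (Fin 4)) = 240 from rfl]
        simp [placeSet],
      paddedCoordinate_placeSet M (by decide) (by decide) (by decide), hdet, Matrix.det_fin_zero]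
    simp only [bracket]
    simp [paddedVector]
    ring
  · obtain ⟨c, hc, hcode, hdet⟩ := exists_columns (R := R) D ![0] (by decide) h
    rw [show D.code = placeSet ⟨c 0, by omega⟩ 4 5 6 by
        rw [hcode, show rowCode (Finset.univ.image ![0] : Finset (Fin 4)) = 112 from rfl]
        simp [placeSet]
        omega,
      paddedCoordinate_placeSet M (by rw [Fin.lt_def]; change (c 0).val < 4; omega) (by decide) (by decide), hdet, Matrix.det_fin_one]
    simp only [bracket, paddedVector_column (n := 4) (by norm_num)]
    simp [paddedVector]
    ring
  · obtain ⟨c, hc, hcode, hdet⟩ := exists_columns (R := R) D ![1] (by decide) h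
    rw [show D.code = placeSet ⟨c 0, by omega⟩ 4 5 7 by
        rw [hcode, show rowCode (Finset.univ.image ![1] : Finset (Fin 4)) = 176 from rfl]
        simp [placeSet]
        omega,
      paddedCoordinate_placeSet M (by rw [Fin.lt_def]; change (c 0).val < 4; omega) (by decide) (by decide), hdet, Matrix.det_fin_one]
    simp only [bracket, paddedVector_column (n := 4) (by norm_num)]
    simp [paddedVector]
    ring
  · obtain ⟨c, hc, hcode, hdet⟩ := exists_columns (R := R) D ![2] (by decide) h
    rw [show D.code = placeSet ⟨c 0, by omega⟩ 4 6 7 by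
        rw [hcode, show rowCode (Finset.univ.image ![2] : Finset (Fin 4)) = 208 from rfl]
        simp [placeSet]
        omega,
      paddedCoordinate_placeSet M (by rw [Fin.lt_def]; change (c 0).val < 4; omega) (by decide) (by decide), hdet, Matrix.det_fin_one]
    simp only [bracket, paddedVector_column (n := 4) (by norm_num)]
    simp [paddedVector]
    ring
  · obtain ⟨c, hc, hcode, hdet⟩ := exists_columns (R := R) D ![3] (by decide) h
    rw [show D.code = placeSet ⟨c 0, by omega⟩ 5 6 7 by
        rw [hcode, show rowCode (Finset.univ.image ![3] : Finset (Fin 4)) = 224 from rfl]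
        simp [placeSet]
        omega,
      paddedCoordinate_placeSet M (by rw [Fin.lt_def]; change (c 0).val < 5; omega) (by decide) (by decide), hdet, Matrix.det_fin_one]
    simp only [bracket, paddedVector_column (n := 4) (by norm_num)]
    simp [paddedVector]
    ring
  · obtain ⟨c, hc, hcode, hdet⟩ := exists_columns (R := R) D ![0, 1] (by decide) h
    have h0 : c 0 < c 1 := hc (by decide)
    rw [show D.code = placeSet ⟨c 0, by omega⟩ ⟨c 1, by omega⟩ 4 5 by
        rw [hcode, show rowCode (Finset.univ.image ![0, 1] : Finset (Fin 4)) = 48 from rfl]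
        simp [Fin.sum_univ_succ, placeSet]
        omega,
      paddedCoordinate_placeSet M h0 (by rw [Fin.lt_def]; change (c 1).val < 4; omega) (by decide), hdet, Matrix.det_fin_two]
    simp only [bracket, paddedVector_column (n := 4) (by norm_num)]
    simp [paddedVector]
    ring
  · obtain ⟨c, hc, hcode, hdet⟩ := exists_columns (R := R) D ![0, 2] (by decide) h
    have h0 : c 0 < c 1 := hc (by decide)
    rw [show D.code = placeSet ⟨c 0, by omega⟩ ⟨c 1, by omega⟩ 4 6 by
        rw [hcode, show rowCode (Finset.univ.image ![0, 2] : Finset (Fin 4)) = 80 from rfl]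
        simp [Fin.sum_univ_succ, placeSet]
        omega,
      paddedCoordinate_placeSet M h0 (by rw [Fin.lt_def]; change (c 1).val < 4; omega) (by decide), hdet, Matrix.det_fin_two]
    simp only [bracket, paddedVector_column (n := 4) (by norm_num)]
    simp [paddedVector]
    ring
  · obtain ⟨c, hc, hcode, hdet⟩ := exists_columns (R := R) D ![0, 3] (by decide) h
    have h0 : c 0 < c 1 := hc (by decide)
    rw [show D.code = placeSet ⟨c 0, by omega⟩ ⟨c 1, by omega⟩ 5 6 by
        rw [hcode, show rowCode (Finset.univ.image ![0, 3] : Finset (Fin 4)) = 96 from rfl]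
        simp [Fin.sum_univ_succ, placeSet]
        omega,
      paddedCoordinate_placeSet M h0 (by rw [Fin.lt_def]; change (c 1).val < 5; omega) (by decide), hdet, Matrix.det_fin_two]
    simp only [bracket, paddedVector_column (n := 4) (by norm_num)]
    simp [paddedVector]
    ring
  · obtain ⟨c, hc, hcode, hdet⟩ := exists_columns (R := R) D ![1, 2] (by decide) h
    have h0 : c 0 < c 1 := hc (by decide)
    rw [show D.code = placeSet ⟨c 0, by omega⟩ ⟨c 1, by omega⟩ 4 7 by
        rw [hcode, show rowCode (Finset.univ.image ![1, 2] : Finset (Fin 4)) = 144 from rfl]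
        simp [Fin.sum_univ_succ, placeSet]
        omega,
      paddedCoordinate_placeSet M h0 (by rw [Fin.lt_def]; change (c 1).val < 4; omega) (by decide), hdet, Matrix.det_fin_two]
    simp only [bracket, paddedVector_column (n := 4) (by norm_num)]
    simp [paddedVector]
    ring
  · obtain ⟨c, hc, hcode, hdet⟩ := exists_columns (R := R) D ![1, 3] (by decide) h
    have h0 : c 0 < c 1 := hc (by decide)
    rw [show D.code = placeSet ⟨c 0, by omega⟩ ⟨c 1, by omega⟩ 5 7 by
        rw [hcode, show rowCode (Finset.univ.image ![1, 3] : Finset (Fin 4)) = 160 from rfl]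
        simp [Fin.sum_univ_succ, placeSet]
        omega,
      paddedCoordinate_placeSet M h0 (by rw [Fin.lt_def]; change (c 1).val < 5; omega) (by decide), hdet, Matrix.det_fin_two]
    simp only [bracket, paddedVector_column (n := 4) (by norm_num)]
    simp [paddedVector]
    ring
  · obtain ⟨c, hc, hcode, hdet⟩ := exists_columns (R := R) D ![2, 3] (by decide) h
    have h0 : c 0 < c 1 := hc (by decide)
    rw [show D.code = placeSet ⟨c 0, by omega⟩ ⟨c 1, by omega⟩ 6 7 by
        rw [hcode, show rowCode (Finset.univ.image ![2, 3] : Finset (Fin 4)) = 192 from rfl]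
        simp [Fin.sum_univ_succ, placeSet]
        omega,
      paddedCoordinate_placeSet M h0 (by rw [Fin.lt_def]; change (c 1).val < 6; omega) (by decide), hdet, Matrix.det_fin_two]
    simp only [bracket, paddedVector_column (n := 4) (by norm_num)]
    simp [paddedVector]
    ring
  · obtain ⟨c, hc, hcode, hdet⟩ := exists_columns (R := R) D ![0, 1, 2] (by decide) h
    have h0 : c 0 < c 1 := hc (by decide)
    have h1 : c 1 < c 2 := hc (by decide)
    rw [show D.code = placeSet ⟨c 0, by omega⟩ ⟨c 1, by omega⟩ ⟨c 2, by omega⟩ 4 by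
        rw [hcode, show rowCode (Finset.univ.image ![0, 1, 2] : Finset (Fin 4)) = 16 from rfl]
        simp [Fin.sum_univ_succ, placeSet]
        omega,
      paddedCoordinate_placeSet M h0 h1 (by rw [Fin.lt_def]; change (c 2).val < 4; omega), hdet, Matrix.det_fin_three]
    simp only [bracket, paddedVector_column (n := 4) (by norm_num)]
    simp [paddedVector]
    ring
  · obtain ⟨c, hc, hcode, hdet⟩ := exists_columns (R := R) D ![0, 1, 3] (by decide) h
    have h0 : c 0 < c 1 := hc (by decide)
    have h1 : c 1 < c 2 := hc (by decide)
    rw [show D.code = placeSet ⟨c 0, by omega⟩ ⟨c 1, by omega⟩ ⟨c 2, by omega⟩ 5 by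
        rw [hcode, show rowCode (Finset.univ.image ![0, 1, 3] : Finset (Fin 4)) = 32 from rfl]
        simp [Fin.sum_univ_succ, placeSet]
        omega,
      paddedCoordinate_placeSet M h0 h1 (by rw [Fin.lt_def]; change (c 2).val < 5; omega), hdet, Matrix.det_fin_three]
    simp only [bracket, paddedVector_column (n := 4) (by norm_num)]
    simp [paddedVector]
    ring
  · obtain ⟨c, hc, hcode, hdet⟩ := exists_columns (R := R) D ![0, 2, 3] (by decide) h
    have h0 : c 0 < c 1 := hc (by decide)
    have h1 : c 1 < c 2 := hc (by decide)
    rw [show D.code = placeSet ⟨c 0, by omega⟩ ⟨c 1, by omega⟩ ⟨c 2, by omega⟩ 6 by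
        rw [hcode, show rowCode (Finset.univ.image ![0, 2, 3] : Finset (Fin 4)) = 64 from rfl]
        simp [Fin.sum_univ_succ, placeSet]
        omega,
      paddedCoordinate_placeSet M h0 h1 (by rw [Fin.lt_def]; change (c 2).val < 6; omega), hdet, Matrix.det_fin_three]
    simp only [bracket, paddedVector_column (n := 4) (by norm_num)]
    simp [paddedVector]
    ring
  · obtain ⟨c, hc, hcode, hdet⟩ := exists_columns (R := R) D ![1, 2, 3] (by decide) h
    have h0 : c 0 < c 1 := hc (by decide)
    have h1 : c 1 < c 2 := hc (by decide)
    rw [show D.code = placeSet ⟨c 0, by omega⟩ ⟨c 1, by omega⟩ ⟨c 2, by omega⟩ 7 by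
        rw [hcode, show rowCode (Finset.univ.image ![1, 2, 3] : Finset (Fin 4)) = 128 from rfl]
        simp [Fin.sum_univ_succ, placeSet]
        omega,
      paddedCoordinate_placeSet M h0 h1 (by rw [Fin.lt_def]; change (c 2).val < 7; omega), hdet, Matrix.det_fin_three]
    simp only [bracket, paddedVector_column (n := 4) (by norm_num)]
    simp [paddedVector]
    ring
  · obtain ⟨c, hc, hcode, hdet⟩ := exists_columns (R := R) D ![0, 1, 2, 3] (by decide) h
    have h0 : c 0 < c 1 := hc (by decide)
    have h1 : c 1 < c 2 := hc (by decide)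
    have h2 : c 2 < c 3 := hc (by decide)
    rw [show D.code = placeSet ⟨c 0, by omega⟩ ⟨c 1, by omega⟩ ⟨c 2, by omega⟩ ⟨c 3, by omega⟩ by
        rw [hcode, show rowCode (Finset.univ.image ![0, 1, 2, 3] : Finset (Fin 4)) = 0 from rfl]
        simp [Fin.sum_univ_succ, placeSet]
        omega,
      paddedCoordinate_placeSet M h0 h1 h2, hdet, Matrix.det_fin_four]
    simp only [bracket, paddedVector_column (n := 4) (by norm_num)]
    simp

/-- Expanding along the unit vectors removes the rows outside the minor, and the bordering columns
contribute an identity block. The signs in `paddedVector` cancel those of the expansion. -/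
theorem paddedCoordinate_code (hn : n ≤ 4) (M : Matrix (Fin n) (Fin n) R) (D : MinorIndex n) :
    paddedCoordinate M D.code = M.minorAt D := by
  interval_cases n
  · exact paddedCoordinate_code_zero M D
  · exact paddedCoordinate_code_one M D
  · exact paddedCoordinate_code_two M D
  · exact paddedCoordinate_code_three M D
  · exact paddedCoordinate_code_four M D

theorem minorAt_of_rows_eq_empty (M : Matrix (Fin n) (Fin n) R) {D : MinorIndex n}
    (hD : D.rows = ∅) : M.minorAt D = 1 := by
  have : IsEmpty (Fin D.rows.card) := by
    rw [hD, Finset.card_empty]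
    infer_instance
  exact Matrix.det_isEmpty

end Minors

/-! ### The theorem -/

section Search

/-- The code of the set of red labels below height `k`, at the left end. -/
def startRow (n k : ℕ) : ℕ := 256 - 2 ^ (8 - (n - k))

/-- The code of the set of blue labels below height `k`, at the left end. -/
def startCol (n k : ℕ) : ℕ := 2 ^ min k n + 15 - 2 ^ n

/-- The codes of the chambers at the left end, and of the region below all strings. -/
def startCodes (n : ℕ) : List ℕ := (List.range 5).map fun k => startRow n k + startCol n k

/-- The lowest red strings at the left end have the largest labels, so the first `n - k` rows are
missing and fill the topmost places. Truncated subtraction covers heights above `n`. -/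
theorem rowCode_leftOrders {n k : ℕ} (hn : n ≤ 4) (hk : k ≤ 4) :
    rowCode (below (leftOrders n .red) k) = startRow n k := by
  interval_cases n <;> interval_cases k <;> decide +kernel

theorem colCode_leftOrders {n k : ℕ} (hn : n ≤ 4) (hk : k ≤ 4) :
    colCode (below (leftOrders n .blue) k) = startCol n k := by
  interval_cases n <;> interval_cases k <;> decide +kernel

/-- The sets of codes of the chambers of the diagrams in normal form. -/
noncomputable def chamberSets (n : ℕ) : List ℕ :=
  -- Four strings of each colour cross twelve times in all; one more step records the set.
  search (startRow n 0) (startRow n 4) (startCol n 0) (startCol n 4) 13 0 0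
    (startRow n 1) (startRow n 2) (startRow n 3) (startCol n 1) (startCol n 2) (startCol n 3)
    (bits (startCodes n)) []

theorem searchFrom_leftOrders {n : ℕ} (hn : n ≤ 4) :
    searchFrom (leftOrders n) 13 0 0 (bits (startCodes n)) [] = chamberSets n := by
  simp only [searchFrom, chamberSets, rowCode_leftOrders hn, colCode_leftOrders hn,
    Nat.reduceLeDiff]

/-- The codes of all minors. -/
def minorCodes (n : ℕ) : List ℕ :=
  (List.range 256).filter fun m =>
    ((List.range 8).map fun i => m / 2 ^ i % 2).sum == 4 &&
      -- The bordering columns `n` to `3` are always present, and the unit vectors at places `4` to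
      -- `7 - n` never occur.
      m / 2 ^ n % 2 ^ (8 - 2 * n) == 2 ^ (4 - n) - 1

theorem code_mem_minorCodes {n : ℕ} (hn : n ≤ 4) (D : MinorIndex n) :
    D.code ∈ minorCodes n := by
  have h : ∀ s t : Finset (Fin n), s.card = t.card → rowCode s + colCode t ∈ minorCodes n := by
    interval_cases n <;> decide +kernel
  exact h D.rows D.cols D.card_eq

theorem code_lt {n : ℕ} (hn : n ≤ 4) (D : MinorIndex n) : D.code < 256 :=
  List.mem_range.mp (List.mem_filter.mp (code_mem_minorCodes hn D)).1

theorem bits_minorCodes_lt (n : ℕ) : bits (minorCodes n) < 2 ^ 256 := by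
  refine Nat.lt_pow_two_of_testBit _ fun i hi => ?_
  rw [← Bool.not_eq_true, testBit_bits]
  exact fun h => absurd (List.mem_range.mp (List.mem_filter.mp h).1) (not_lt.mpr hi)

/-- The chamber sets from which the rules do not lead to all minors. -/
noncomputable def exceptionalSets (n : ℕ) : List ℕ :=
  force (bits (minorCodes n)) fun full => forceRules threeTermRules fun t =>
    forceRules relationRules fun u =>
      -- Only sets not settled by three-term relations in lanes of width 256 go through the larger
      -- system with differences of products.
      bySegments 256 (unresolved 336 full (u ++ t) 4) 24
        (bySegments 256 (unresolved 256 full t 3) 24 (chamberSets n))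

/-- The finite computation on which the theorem rests: no chamber set withstands both passes. -/
theorem exceptionalSets_eq_nil {n : ℕ} (hn : n ≤ 4) : exceptionalSets n = [] := by
  interval_cases n
  · decide +kernel
  · decide +kernel
  · decide +kernel
  · decide +kernel
  · decide +kernel

end Search

section Main

variable {n : ℕ}

/-- The value at a place in a lane, as a function of the matrix. -/
def placeFunction (n i : ℕ) : MatrixFunction.{u} n := fun _ _ M => placeValue (paddedCoordinate M) i

theorem placeFunction_code (hn : n ≤ 4) (D : MinorIndex n) (K : Type u) [Field K]
    (M : Matrix (Fin n) (Fin n) K) : placeFunction n D.code K M = M.minorAt D :=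
  (placeValue_of_lt _ (code_lt hn D)).trans (paddedCoordinate_code hn M D)

theorem isPositiveLaurent_of_mem_chamberSets (hn : n ≤ 4) {L : Set (MinorIndex n)} {c : ℕ}
    (hc : c ∈ chamberSets n)
    (hA : ∀ i, c.testBit i → IsPositiveLaurentUnit L (placeFunction.{u} n i))
    (D : MinorIndex n) : IsPositiveLaurent L (fun _ _ M => M.minorAt D : MatrixFunction.{u} n) := by
  have hp : ∀ (K : Type u) [Field K] (M : Matrix (Fin n) (Fin n) K),
      IsPlucker (paddedCoordinate M) := fun K _ M => isPlucker_paddedCoordinate M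
  have hAG : ∀ i, IsPositiveLaurentUnit L (placeFunction.{u} n i) →
      IsPositiveLaurent L (placeFunction.{u} n i) := fun i h => h.1
  have hlt := bits_minorCodes_lt n
  have h₁ := mem_bySegments (k := 256) (fun l hc => mem_unresolved (m := 3) (l := l) hAG
    (isSound_threeTermRules le_rfl hp) hlt hc hA) 24 _ hc
  have h₂ : c ∈ exceptionalSets n ∨ ∀ i, (bits (minorCodes n)).testBit i →
      IsPositiveLaurent L (placeFunction.{u} n i) := by
    unfold exceptionalSets
    rw [force_eq, forceRules_eq, forceRules_eq]
    rcases h₁ with h₁ | h₁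
    · refine mem_bySegments (fun l hc => mem_unresolved hAG ?_
        (hlt.trans_le (Nat.pow_le_pow_right two_pos (by norm_num))) hc hA) 24 _ h₁
      intro r hr
      rcases List.mem_append.mp hr with hr | hr
      · exact isSound_relationRules le_rfl hp r hr
      · exact isSound_threeTermRules (by norm_num) hp r hr
    · exact Or.inr h₁
  rw [exceptionalSets_eq_nil hn] at h₂
  have h := h₂.resolve_left List.not_mem_nil D.code
    (testBit_bits.mpr (code_mem_minorCodes hn D))
  exact h.congr fun K _ M _ => (placeFunction_code hn D K M).symm

theorem DoubleWiringDiagram.isPositiveLaurent (hn : n ≤ 4) (w : DoubleWiringDiagram n)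
    (D : MinorIndex n) :
    IsPositiveLaurent w.chamberLabels (fun _ _ M => M.minorAt D : MatrixFunction.{u} n) := by
  obtain ⟨w', hw', hchain, hsub⟩ := exists_inOrder _ _ (w.isComplete_foldl [] w.crossings rfl)
  have hsub := hsub.trans (chambers_foldl_subset w [] w.crossings rfl)
  have hunit : ∀ D ∈ chambers (leftOrders n) w',
      IsPositiveLaurentUnit w.chamberLabels (placeFunction.{u} n D.code) := fun D hD =>
    .of_mem (hsub hD) fun K _ M => placeFunction_code hn D K M
  have hone : ∀ D : MinorIndex n, D.rows = ∅ →
      IsPositiveLaurentUnit w.chamberLabels (placeFunction.{u} n D.code) := fun D hD =>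
    .of_eq_one fun K _ M =>
      (placeFunction_code hn D K M).trans (minorAt_of_rows_eq_empty M hD)
  -- The initial set of the search also contains height `0`, where the minor is empty, and heights
  -- above `n`, which repeat the top chamber.
  have hstart : ∀ k, IsPositiveLaurentUnit w.chamberLabels
      (placeFunction.{u} n (chamberAt (leftOrders n) k).code) := by
    intro k
    rcases Nat.eq_zero_or_pos k with rfl | hk
    · exact hone _ (below_zero _)
    rcases Nat.eq_zero_or_pos n with rfl | hn0
    · exact hone _ (Subsingleton.elim _ _)
    have e : chamberAt (leftOrders n) k = chamberAt (leftOrders n) (min k n - 1 + 1) := by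
      rw [Nat.sub_add_cancel (by omega)]
      rcases le_total k n with h | h
      · rw [min_eq_left h]
      · ext1 <;> simp only [chamberAt, below_of_le _ h, below_of_le _ (le_min h le_rfl)]
    rw [e]
    refine hunit _ ?_
    cases w' with
    | nil => exact ⟨_, by omega, rfl⟩
    | cons x v => exact Or.inl ⟨_, by omega, rfl⟩
  obtain ⟨c, hc, hA⟩ := exists_mem_searchFrom hn
    (fun i => IsPositiveLaurentUnit w.chamberLabels (placeFunction.{u} n i)) 13 (leftOrders n) w'
    0 0 (bits (startCodes n)) [] hw' hchain
    (fun _ _ _ => ⟨fun _ => Nat.zero_le _, fun _ => Nat.zero_le _⟩) hunit (by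
      intro i hi
      obtain ⟨k, hk, rfl⟩ := List.mem_map.mp (testBit_bits.mp hi)
      have hk : k ≤ 4 := Nat.lt_succ_iff.mp (List.mem_range.mp hk)
      rw [← rowCode_leftOrders hn hk, ← colCode_leftOrders hn hk]
      exact hstart k)
  rw [searchFrom_leftOrders hn] at hc
  exact isPositiveLaurent_of_mem_chamberSets hn hc hA D

end Main

theorem mainTheorem3 (n : ℕ) (hn : n ≤ 4) (w : CommutationClass n) (D : MinorIndex n) :
    ∃ f : MvLaurent w.chamberLabels, f.HasPositiveCoeffs ∧
      ∀ (K : Type*) [Field K] (M : Matrix (Fin n) (Fin n) K),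
        (∀ C ∈ w.chamberLabels, M.minorAt C ≠ 0) →
          M.minorAt D = f.evalAt (fun C => M.minorAt C.1) := by
  induction w using Quotient.inductionOn with
  | h w => exact w.isPositiveLaurent hn D
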